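/- Let $(\Omega,\mathcal F,(\mathcal F_t)_{t\ge 0},\mathbb Q)$ be a filtered probability space carrying a standard Brownian motion $W$ and a subordinator $\Lambda$ (a Lévy process with nondecreasing paths and $\Lambda_0=0$) independent of $W$. Put $L_t=W_{\Lambda_t}$ and assume that $L$ is a Lévy process relative to $(\mathcal F_t)$, that is, $L$ is adapted and $L_t-L_s$ is independent of $\mathcal F_s$ for $s\le t$. Let $k_\Lambda(v)=\ln \mathsf E^{\mathbb Q}[e^{v\Lambda_1}]$. Let $p>q\ge 0$ be integers, $a_1,\dots,a_p\in\mathbb R$, $\mathbf b=(b_0,\dots,b_{p-1})^\top\in\mathbb R^p$ with $b_{q+1}=\dots=b_{p-1}=0$, $\mathbf e=(0,\dots,0,1)^\top\in\mathbb R^p$, and let $\mathbf A$ be the $p\times p$ companion matrix with ones on the superdiagonal, last row $(-a_p,-a_{p-1},\dots,-a_1)$, and all other entries $0$. Let $X$ be an adapted càdlàg $\mathbb R^p$-valued solution of $$dX_t=\mathbf A X_{t-}\,dt+\mathbf e\,dL_t ,$$ and let $Y_t=\mathbf b^\top X_t$ (a CARMA$(p,q)$ process driven by the time-changed Brownian motion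 $L$). Let $0\le t_0\le T$ and let $S$ be an adapted spot price process with $S_{t_0}>0$ and $S_T=S_{t_0}e^{Y_T}$ almost surely. Write $$g(u)=\tfrac12\,\mathbf b^\top e^{\mathbf A(T-u)}\mathbf e\mathbf e^\top e^{\mathbf A^\top(T-u)}\mathbf b ,$$ and assume that $\mathsf E^{\mathbb Q}[e^{g(u)\Lambda_1}]<\infty$ for every $u\in[t_0,T]$. Then $u\mapsto k_\Lambda(g(u))$ is integrable on $[t_0,T]$, the futures price $F^T_{t_0}=\mathsf E^{\mathbb Q}[S_T\mid\mathcal F_{t_0}]$ (the conditional expectation of a nonnegative random variable) is almost surely positive and finite, and almost surely $$\ln F^T_{t_0}=\ln S_{t_0}+\mathbf b^\top e^{\mathbf A(T-t_0)}X_{t_0}+\int_{t_0}^T k_\Lambda\!\left(\tfrac12\,\mathbf b^\top e^{\mathbf A(T-u)}\mathbf e\mathbf e^\top e^{\mathbf A^\top(T-u)}\mathbf b\right)du .$$ If moreover $S_T$ is integrable, the same holds with the usual $L^1$ conditional expectation $\mathsf E^{\mathbb Q}[S_T\mid\mathcal F_{t_0}]$ in place of $F^T_{t_0}$. -/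

import Mathlib

open MeasureTheory ProbabilityTheory Filter Topology Matrix
open scoped NNReal ENNReal

namespace TCBmCARMA

/-- A path indexed by `[0, ∞)` is càdlàg: right-continuous with left limits
(the left-limit condition is vacuous at time `0`). -/
def IsCadlagPath {E : Type*} [TopologicalSpace E] (x : ℝ≥0 → E) : Prop :=
  ∀ t, ContinuousWithinAt x (Set.Ici t) t ∧ ∃ l, Tendsto x (𝓝[<] t) (𝓝 l)

/-- A subordinator: a Lévy process started at `0` whose paths are almost surely nondecreasing
and right-continuous (left limits exist by monotonicity). -/
structure IsSubordinator {Ω : Type*} [MeasurableSpace Ω] (Q : Measure Ω) (Λ : ℝ≥0 → Ω → ℝ≥0) :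
    Prop where
  measurable : ∀ t, Measurable (Λ t)
  zero : ∀ᵐ ω ∂Q, Λ 0 ω = 0
  indep_increments : HasIndepIncrements (fun t ω => (Λ t ω : ℝ)) Q
  stationary_increments : ∀ s t,
    IdentDistrib (fun ω => (Λ (s + t) ω : ℝ) - (Λ s ω : ℝ)) (fun ω => (Λ t ω : ℝ)) Q Q
  mono : ∀ᵐ ω ∂Q, Monotone fun t => Λ t ω
  right_cont : ∀ᵐ ω ∂Q, ∀ t, ContinuousWithinAt (fun s => Λ s ω) (Set.Ici t) t

/-- The time-changed process `L_t = W_{Λ_t}`. -/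
def timeChange {Ω : Type*} (W : ℝ≥0 → Ω → ℝ) (Λ : ℝ≥0 → Ω → ℝ≥0) : ℝ≥0 → Ω → ℝ :=
  fun t ω => W (Λ t ω) ω

/-- The process `L` is adapted to `ℱ` and each increment `L_t - L_s`, `s ≤ t`, is independent of
`ℱ_s`: the requirement that links a Lévy process to the filtration of the space on which it
lives. -/
structure IsDrivingNoise {Ω : Type*} {mΩ : MeasurableSpace Ω} (Q : Measure Ω)
    (ℱ : Filtration ℝ≥0 mΩ) (L : ℝ≥0 → Ω → ℝ) : Prop where
  adapted : ∀ t, Measurable[ℱ t] (L t)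
  indep : ∀ s t, s ≤ t →
    Indep (MeasurableSpace.comap (fun ω => L t ω - L s ω) inferInstance) (ℱ s) Q

/-- The `p × p` companion matrix with ones on the superdiagonal and last row
`(-a_p, -a_{p-1}, …, -a_1)`; the coefficient `a_k` is `a (k - 1)`. -/
def companion {p : ℕ} (a : Fin p → ℝ) : Matrix (Fin p) (Fin p) ℝ :=
  Matrix.of fun i j =>
    if (i : ℕ) + 1 = p then -a (Fin.rev j) else if (j : ℕ) = (i : ℕ) + 1 then 1 else 0

/-- The vector `e = (0, …, 0, 1)ᵀ` of length `p`. -/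
def lastUnit (p : ℕ) : Fin p → ℝ :=
  fun i => if (i : ℕ) + 1 = p then 1 else 0

/-- `X` is the state process of a CARMA model with autoregressive coefficients `a` and driving
noise `L`: an adapted càdlàg solution of `dX_t = A X_{t-} dt + e dL_t`. The coefficient `e` is
constant, so the equation is the pathwise identity below; a càdlàg path and its left limits
differ at countably many times only, so `X_u` may replace `X_{u-}` in the `du`-integral. -/
structure IsCARMAState {Ω : Type*} {mΩ : MeasurableSpace Ω} {p : ℕ} (Q : Measure Ω)
    (ℱ : Filtration ℝ≥0 mΩ) (a : Fin p → ℝ) (L : ℝ≥0 → Ω → ℝ) (X : ℝ≥0 → Ω → (Fin p → ℝ)) :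
    Prop where
  adapted : ∀ t, Measurable[ℱ t] (X t)
  cadlag : ∀ᵐ ω ∂Q, IsCadlagPath fun t => X t ω
  sde : ∀ᵐ ω ∂Q, ∀ s t : ℝ≥0, s ≤ t →
    X t ω = X s ω + (∫ u in (s : ℝ)..(t : ℝ), companion a *ᵥ X u.toNNReal ω)
      + (L t ω - L s ω) • lastUnit p

/-- `bᵀ e^{A τ} e eᵀ e^{Aᵀ τ} b`. -/
noncomputable def kernelSq {p : ℕ} (a b : Fin p → ℝ) (τ : ℝ) : ℝ :=
  b ⬝ᵥ ((NormedSpace.exp (τ • companion a) * vecMulVec (lastUnit p) (lastUnit p) *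
    NormedSpace.exp (τ • (companion a)ᵀ)) *ᵥ b)

/-- The cumulant generating function `k_Λ(v) = ln E[exp (v Λ_1)]`. -/
noncomputable def cumulant {Ω : Type*} [MeasurableSpace Ω] (Q : Measure Ω)
    (Λ : ℝ≥0 → Ω → ℝ≥0) (v : ℝ) : ℝ :=
  cgf (fun ω => (Λ 1 ω : ℝ)) Q v

/-- The futures price `F^T_{t₀} = E^Q[S_T | ℱ_{t₀}]` of a positive spot price `S`: the conditional
expectation of a nonnegative random variable, with values in `[0, ∞]`. -/
noncomputable def futuresPrice {Ω : Type*} {mΩ : MeasurableSpace Ω} (Q : Measure Ω)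
    (ℱ : Filtration ℝ≥0 mΩ) (S : ℝ≥0 → Ω → ℝ) (t₀ T : ℝ≥0) : Ω → ℝ≥0∞ :=
  condLExp (ℱ t₀) Q fun ω => ENNReal.ofReal (S T ω)

end TCBmCARMA

/-! Put `c u` for bᵀe^{A(T-u)}e, so that g = c²/2. Variation of constants gives bᵀX_T =
bᵀe^{A(T-t₀)}X_{t₀} + J, where J is the integral of c against L over [t₀, T]. The first term is
known at t₀ and J is independent of ℱ_{t₀}, so F = S_{t₀} exp(bᵀe^{A(T-t₀)}X_{t₀}) E[e^J], and it
remains to compute E[e^J].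

No stochastic integral is needed: J is a pathwise limit of Riemann sums Jₙ (`tendsto_noise_sum`),
and it inherits independence of the past from them (`indep_comap_of_tendsto`). Given the clock Λ, Jₙ
is centred Gaussian with variance Σ cᵢ²ΔΛᵢ (`lintegral_exp_sum_timeChange`). Hence E[e^{Jₙ}] =
E[exp(Σ cᵢ²ΔΛᵢ/2)], which is the exponential of a Riemann sum of k_Λ(c²/2)
(`IsSubordinator.lintegral_exp`).

The delicate point is E[e^{Jₙ}] → E[e^J]. Only e^{vΛ₁} with v = max g is integrable, so there may be
no bound in any L^r with r > 1. `tendsto_lintegral_exp_sum_timeChange` splits according to the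
increment M of the clock over [t₀, T]: the part on M > K is at most E[e^{vM}; M > K], small
uniformly in n, and on M ≤ K second moments are bounded by e^{4vK}. -/

namespace TCBmCARMA

/-! ### Riemann sums over equal partitions. -/

/-- The `i`-th point of the partition of `[a, a + d]` into `n + 1` intervals of equal length. -/
noncomputable def gridPoint (a d : ℝ≥0) (n i : ℕ) : ℝ≥0 := a + i * (d / (n + 1))

lemma gridPoint_zero (a d : ℝ≥0) (n : ℕ) : gridPoint a d n 0 = a := by simp [gridPoint]

lemma gridPoint_last (a d : ℝ≥0) (n : ℕ) : gridPoint a d n (n + 1) = a + d := by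
  have : ((n : ℝ≥0) + 1) ≠ 0 := by positivity
  simp only [gridPoint, Nat.cast_add, Nat.cast_one]
  field_simp

lemma gridPoint_succ (a d : ℝ≥0) (n i : ℕ) :
    gridPoint a d n (i + 1) = gridPoint a d n i + d / (n + 1) := by
  simp only [gridPoint]; push_cast; ring

lemma gridPoint_mono (a d : ℝ≥0) (n : ℕ) : Monotone (gridPoint a d n) :=
  monotone_nat_of_le_succ fun i => by rw [gridPoint_succ]; exact le_self_add

lemma left_le_gridPoint (a d : ℝ≥0) (n i : ℕ) : a ≤ gridPoint a d n i := le_self_add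

lemma gridPoint_le_right (a d : ℝ≥0) {n i : ℕ} (hi : i ≤ n + 1) : gridPoint a d n i ≤ a + d :=
  (gridPoint_mono a d n hi).trans (gridPoint_last a d n).le

/-- Sums of integrals over the intervals of a partition, with an integrand that may depend on the
end points of the interval, converge to the integral of the limiting integrand. -/
lemma tendsto_sum_integral_gridPoint (a d : ℝ≥0) (Φ : ℝ≥0 → ℝ≥0 → ℝ → ℝ) (φ : ℝ → ℝ) (C : ℝ)
    (hmeas : ∀ l r, Measurable (Φ l r))
    (hbound : ∀ (l r : ℝ≥0) (u : ℝ), a ≤ l → l ≤ u → u ≤ r → r ≤ a + d → |Φ l r u| ≤ C)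
    (hlim : ∀ u : ℝ, a < u → u ≤ a + d → ∀ l r : ℕ → ℝ≥0, (∀ n, a ≤ l n) → (∀ n, l n ≤ u) →
      (∀ n, u ≤ r n) → (∀ n, r n ≤ a + d) → Tendsto l atTop (𝓝 u.toNNReal) →
      Tendsto r atTop (𝓝 u.toNNReal) → Tendsto (fun n => Φ (l n) (r n) u) atTop (𝓝 (φ u))) :
    Tendsto (fun n : ℕ => ∑ i ∈ Finset.range (n + 1),
      ∫ u in (gridPoint a d n i : ℝ)..(gridPoint a d n (i + 1) : ℝ),
        Φ (gridPoint a d n i) (gridPoint a d n (i + 1)) u) atTop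
      (𝓝 (∫ u in (a : ℝ)..(a + d : ℝ), φ u)) := by
  rcases eq_or_ne d 0 with rfl | hd
  · simp [gridPoint]
  have hd : 0 < d := pos_iff_ne_zero.2 hd
  let δ : ℕ → ℝ≥0 := fun n => d / (n + 1)
  have hδ : ∀ n, 0 < δ n := fun n => by positivity
  have hδ0 : Tendsto (fun n => (δ n : ℝ)) atTop (𝓝 0) := by
    have := (tendsto_one_div_add_atTop_nhds_zero_nat (𝕜 := ℝ)).const_mul (d : ℝ)
    simpa [δ, div_eq_mul_inv] using this
  -- Index of the interval containing u. The ceiling minus one fits intervals open on the left and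
  -- closed on the right, the convention of interval integrals, so that the whole sum becomes a
  -- single integral of `F n`.
  let κ : ℕ → ℝ → ℕ := fun n u => ⌈(u - a) / δ n⌉₊ - 1
  let F : ℕ → ℝ → ℝ := fun n u =>
    Φ (gridPoint a d n (κ n u)) (gridPoint a d n (κ n u + 1)) u
  have hgp : ∀ n i, (gridPoint a d n i : ℝ) = a + i * δ n := fun n i => by
    simp [gridPoint, δ]
  have hκm : ∀ n, Measurable (κ n) := fun n => by
    have : Measurable fun u : ℝ => ⌈(u - a) / δ n⌉₊ := Nat.measurable_ceil.comp (by fun_prop)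
    exact (measurable_of_countable (fun k : ℕ => k - 1)).comp this
  have hFm : ∀ n, Measurable (F n) := fun n => by
    have h : Measurable fun q : ℕ × ℝ =>
        Φ (gridPoint a d n q.1) (gridPoint a d n (q.1 + 1)) q.2 :=
      measurable_from_prod_countable_right fun k =>
        hmeas (gridPoint a d n k) (gridPoint a d n (k + 1))
    have := h.comp ((hκm n).prodMk measurable_id)
    exact this
  have hκ : ∀ n i (u : ℝ), (gridPoint a d n i : ℝ) < u → u ≤ gridPoint a d n (i + 1) →
      κ n u = i := by
    intro n i u h1 h2
    have hp : (0 : ℝ) < δ n := hδ n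
    rw [hgp] at h1 h2
    have : ⌈(u - a) / δ n⌉₊ = i + 1 := by
      rw [Nat.ceil_eq_iff (by omega)]
      constructor
      · rw [lt_div_iff₀ hp]; simp; linarith
      · rw [div_le_iff₀ hp]; linarith
    simp [κ, this]
  have hκ' : ∀ n (u : ℝ), a < u → u ≤ a + d → (gridPoint a d n (κ n u) : ℝ) < u ∧
      u ≤ gridPoint a d n (κ n u + 1) ∧ κ n u + 1 ≤ n + 1 := by
    intro n u h1 h2
    have hp : (0 : ℝ) < δ n := hδ n
    have hpos : 0 < (u - a) / δ n := div_pos (by linarith) hp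
    have hc : 0 < ⌈(u - a) / δ n⌉₊ := Nat.ceil_pos.2 hpos
    have e : κ n u + 1 = ⌈(u - a) / δ n⌉₊ := by simp only [κ]; omega
    have h3 := Nat.le_ceil ((u - a) / δ n)
    have h4 := Nat.ceil_lt_add_one hpos.le
    rw [← e] at h3 h4
    rw [hgp, hgp]
    refine ⟨?_, ?_, ?_⟩
    · have : (κ n u : ℝ) < (u - a) / δ n := by push_cast at h4; linarith
      rw [lt_div_iff₀ hp] at this; linarith
    · rw [div_le_iff₀ hp] at h3; linarith
    · rw [e, Nat.ceil_le, div_le_iff₀ hp]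
      have : ((n + 1 : ℕ) : ℝ) * δ n = d := by
        simp only [δ]; push_cast; field_simp
      rw [this]; linarith
  have hFb : ∀ n (u : ℝ), a < u → u ≤ a + d → |F n u| ≤ C := by
    intro n u h1 h2
    obtain ⟨h3, h4, h5⟩ := hκ' n u h1 h2
    exact hbound _ _ _ (left_le_gridPoint ..) h3.le h4 (gridPoint_le_right _ _ h5)
  have hsum : ∀ n, ∑ i ∈ Finset.range (n + 1),
      ∫ u in (gridPoint a d n i : ℝ)..(gridPoint a d n (i + 1) : ℝ),
        Φ (gridPoint a d n i) (gridPoint a d n (i + 1)) u = ∫ u in (a : ℝ)..(a + d : ℝ), F n u := by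
    intro n
    have hint : ∀ k < n + 1, IntervalIntegrable (F n) volume (gridPoint a d n k : ℝ)
        (gridPoint a d n (k + 1) : ℝ) := by
      intro k hk
      have hle : (gridPoint a d n k : ℝ) ≤ gridPoint a d n (k + 1) :=
        NNReal.coe_le_coe.2 (gridPoint_mono a d n (Nat.le_succ k))
      refine (intervalIntegrable_const (c := C)).mono_fun (hFm n).aestronglyMeasurable ?_
      refine (ae_restrict_iff' measurableSet_uIoc).2 (ae_of_all _ fun u hu => ?_)
      rw [Set.uIoc_of_le hle] at hu
      have h1 : (a : ℝ) < u := lt_of_le_of_lt (NNReal.coe_le_coe.2 (left_le_gridPoint a d n k)) hu.1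
      have h2 : u ≤ a + d := hu.2.trans (by exact_mod_cast gridPoint_le_right a d hk)
      exact (hFb n u h1 h2).trans (le_abs_self C)
    have := intervalIntegral.sum_integral_adjacent_intervals
      (a := fun k => (gridPoint a d n k : ℝ)) hint
    rw [gridPoint_zero, gridPoint_last] at this
    push_cast at this
    rw [← this]
    refine Finset.sum_congr rfl fun i hi => ?_
    have hle : (gridPoint a d n i : ℝ) ≤ gridPoint a d n (i + 1) :=
      NNReal.coe_le_coe.2 (gridPoint_mono a d n (Nat.le_succ i))
    refine intervalIntegral.integral_congr_ae (ae_of_all _ fun u hu => ?_)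
    rw [Set.uIoc_of_le hle] at hu
    simp only [F, hκ n i u hu.1 hu.2]
  simp_rw [hsum]
  have had : (a : ℝ) ≤ a + d := by simp
  refine intervalIntegral.tendsto_integral_filter_of_dominated_convergence (fun _ => C)
    (Eventually.of_forall fun n => (hFm n).aestronglyMeasurable)
    (Eventually.of_forall fun n => ae_of_all _ fun u hu => ?_) intervalIntegrable_const
    (ae_of_all _ fun u hu => ?_)
  · rw [Set.uIoc_of_le had] at hu
    exact hFb n u hu.1 hu.2
  · rw [Set.uIoc_of_le had] at hu
    have hu0 : (0 : ℝ) ≤ u := a.2.trans hu.1.le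
    have key := fun n => hκ' n u hu.1 hu.2
    have hstep : ∀ n, (gridPoint a d n (κ n u + 1) : ℝ) = gridPoint a d n (κ n u) + δ n :=
      fun n => by rw [gridPoint_succ]; simp [δ]
    have hl : Tendsto (fun n => (gridPoint a d n (κ n u) : ℝ)) atTop (𝓝 u) := by
      have : Tendsto (fun n => u - (δ n : ℝ)) atTop (𝓝 u) := by simpa using hδ0.const_sub u
      refine tendsto_of_tendsto_of_tendsto_of_le_of_le this tendsto_const_nhds (fun n => ?_)
        fun n => (key n).1.le
      have := (key n).2.1
      rw [hstep] at this
      simp only; linarith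
    have hr : Tendsto (fun n => (gridPoint a d n (κ n u + 1) : ℝ)) atTop (𝓝 u) := by
      simp_rw [hstep]
      simpa using hl.add hδ0
    have conv : ∀ {f : ℕ → ℝ≥0}, Tendsto (fun n => (f n : ℝ)) atTop (𝓝 u) →
        Tendsto f atTop (𝓝 u.toNNReal) := by
      intro f hf
      rw [← NNReal.tendsto_coe]
      simpa [hu0] using hf
    exact hlim u hu.1 hu.2 _ _ (fun n => left_le_gridPoint ..) (fun n => (key n).1.le)
      (fun n => (key n).2.1) (fun n => gridPoint_le_right _ _ (key n).2.2) (conv hl) (conv hr)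

/-- Riemann sums of a continuous function over equal partitions converge to its integral. -/
lemma tendsto_riemannSum (a d : ℝ≥0) (f : ℝ → ℝ) (hf : ContinuousOn f (Set.Icc (a : ℝ) (a + d))) :
    Tendsto (fun n : ℕ => ∑ i ∈ Finset.range (n + 1),
      (d / (n + 1) : ℝ) * f (gridPoint a d n i)) atTop (𝓝 (∫ u in (a : ℝ)..(a + d : ℝ), f u)) := by
  obtain ⟨C, hC⟩ := isCompact_Icc.exists_bound_of_continuousOn hf
  have := tendsto_sum_integral_gridPoint a d (fun l _ _ => f l) f C (fun _ _ => measurable_const)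
    (fun l r u h1 h2 h3 h4 => hC l ⟨by exact_mod_cast h1, h2.trans (h3.trans (by exact_mod_cast h4))⟩)
    (fun u h1 h2 l r h3 h4 h5 h6 h7 h8 => by
      have hu0 : (0 : ℝ) ≤ u := a.2.trans h1.le
      refine (hf u ⟨h1.le, h2⟩).tendsto.comp (tendsto_nhdsWithin_iff.2 ⟨?_, ?_⟩)
      · rw [← NNReal.tendsto_coe] at h7
        simpa [hu0] using h7
      · exact Eventually.of_forall fun n => ⟨by exact_mod_cast h3 n, (h4 n).trans h2⟩)
  refine this.congr fun n => Finset.sum_congr rfl fun i _ => ?_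
  rw [intervalIntegral.integral_const, gridPoint_succ]
  simp

/-! ### Càdlàg paths and variation of constants. -/

/-- A right-continuous path is Borel measurable. -/
lemma measurable_of_rightContinuous {E : Type*} [TopologicalSpace E]
    [TopologicalSpace.PseudoMetrizableSpace E] [MeasurableSpace E] [BorelSpace E] {x : ℝ≥0 → E}
    (hx : ∀ t, ContinuousWithinAt x (Set.Ici t) t) : Measurable x := by
  -- A grid point to the right of t within 1/(n+1). Along it x is a function of an integer-valued
  -- measurable map, and right continuity gives the limit.
  let s : ℕ → ℝ≥0 → ℝ≥0 := fun n t => ((⌊(n + 1) * t⌋₊ : ℝ≥0) + 1) / (n + 1)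
  have hs1 : ∀ n t, t ≤ s n t := fun n t => by
    have := (Nat.lt_floor_add_one (((n : ℝ≥0) + 1) * t)).le
    rw [le_div_iff₀ (by positivity), mul_comm]
    exact this
  have hs2 : ∀ n t, s n t ≤ t + 1 / (n + 1) := fun n t => by
    have := Nat.floor_le (zero_le (a := ((n : ℝ≥0) + 1) * t))
    have e : (t + 1 / ((n : ℝ≥0) + 1)) * (n + 1) = (n + 1) * t + 1 := by field_simp
    rw [div_le_iff₀ (by positivity), e]
    gcongr
  refine measurable_of_tendsto_metrizable (f := fun n t => x (s n t)) (fun n => ?_)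
    (tendsto_pi_nhds.2 fun t => ?_)
  · have h1 : Measurable fun t : ℝ≥0 => ⌊((n : ℝ≥0) + 1) * t⌋₊ :=
      Nat.measurable_floor.comp (by fun_prop)
    exact (measurable_of_countable fun k : ℕ => x (((k : ℝ≥0) + 1) / (n + 1))).comp h1
  · refine (hx t).tendsto.comp (tendsto_nhdsWithin_iff.2
      ⟨?_, Eventually.of_forall fun n => hs1 n t⟩)
    have : Tendsto (fun n : ℕ => t + 1 / ((n : ℝ≥0) + 1)) atTop (𝓝 t) := by
      rw [← NNReal.tendsto_coe]
      push_cast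
      simpa using tendsto_one_div_add_atTop_nhds_zero_nat (𝕜 := ℝ) |>.const_add (t : ℝ)
    exact tendsto_of_tendsto_of_tendsto_of_le_of_le tendsto_const_nhds this (fun n => hs1 n t)
      fun n => hs2 n t

/-- A càdlàg path is bounded on compact intervals. -/
lemma IsCadlagPath.exists_bound {E : Type*} [SeminormedAddCommGroup E] {x : ℝ≥0 → E}
    (hx : IsCadlagPath x) (T : ℝ≥0) : ∃ C, ∀ t ≤ T, ‖x t‖ ≤ C := by
  have : Bornology.IsBounded (x '' Set.Icc 0 T) := by
    refine isCompact_Icc.induction_on (p := fun s => Bornology.IsBounded (x '' s)) (by simp)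
      (fun s t hst ht => ht.subset (Set.image_mono hst))
      (fun s t hs ht => by rw [Set.image_union]; exact hs.union ht) fun t _ => ?_
    obtain ⟨h1, l, h2⟩ := hx t
    have b1 := Metric.ball_mem_nhds (x t) one_pos
    have b2 := Metric.ball_mem_nhds l one_pos
    -- Near t the path stays close to its left limit on the left and to its value on the right, so
    -- it is locally bounded; compactness does the rest.
    refine ⟨x ⁻¹' (Metric.ball l 1 ∪ Metric.ball (x t) 1), ?_, ?_⟩
    · refine mem_nhdsWithin_of_mem_nhds ?_
      rw [← nhdsLT_sup_nhdsGE t]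
      refine ⟨mem_of_superset (h2 b2) fun y hy => Or.inl hy,
        mem_of_superset (h1 b1) fun y hy => Or.inr hy⟩
    · exact (Metric.isBounded_ball.union Metric.isBounded_ball).subset (Set.image_preimage_subset ..)
  obtain ⟨C, hC⟩ := this.exists_norm_le
  exact ⟨C, fun t ht => hC _ ⟨t, ⟨zero_le, ht⟩, rfl⟩⟩

/-- Variation of constants for the linear equation `dx_t = A x_t dt + e dℓ_t`: the Riemann sums of
`ρ(u) e` against `ℓ` converge to the increment of `ρ(u) x_u`, if `ρ' = -ρ A`. -/
lemma tendsto_sum_increments_of_linear_equation {E : Type*} [NormedAddCommGroup E]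
    [NormedSpace ℝ E] [CompleteSpace E] [MeasurableSpace E] [BorelSpace E]
    [SecondCountableTopology E] {A : E →L[ℝ] E} {e : E} {ρ : ℝ → E →L[ℝ] ℝ} (hρc : Continuous ρ)
    (hρ : ∀ u v, HasDerivAt (fun u => ρ u v) (-ρ u (A v)) u) {x : ℝ≥0 → E} {ℓ : ℝ≥0 → ℝ}
    (hx : IsCadlagPath x)
    (hsde : ∀ s t : ℝ≥0, s ≤ t →
      x t = x s + (∫ u in (s : ℝ)..(t : ℝ), A (x u.toNNReal)) + (ℓ t - ℓ s) • e) (a d : ℝ≥0) :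
    Tendsto (fun n : ℕ => ∑ i ∈ Finset.range (n + 1), ρ (gridPoint a d n i) e *
      (ℓ (gridPoint a d n (i + 1)) - ℓ (gridPoint a d n i))) atTop
      (𝓝 (ρ (a + d : ℝ≥0) (x (a + d)) - ρ a (x a))) := by
  obtain ⟨C, hC⟩ := hx.exists_bound (a + d)
  obtain ⟨R, hR⟩ := (isCompact_Icc (a := (a : ℝ)) (b := a + d)).exists_bound_of_continuousOn
    hρc.continuousOn
  have had : (a : ℝ) ≤ a + d := by simp
  have hR0 : 0 ≤ R := (norm_nonneg _).trans (hR a ⟨le_rfl, had⟩)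
  have hC0 : 0 ≤ C := (norm_nonneg _).trans (hC a le_self_add)
  have hxm : Measurable fun u : ℝ => x u.toNNReal :=
    (measurable_of_rightContinuous fun t => (hx t).1).comp measurable_real_toNNReal
  have hAm : Measurable fun u : ℝ => A (x u.toNNReal) := A.continuous.measurable.comp hxm
  -- The error density in summation by parts: ρ_l e Δℓ = Δ(ρx) - ∫ Φ. The state in the second term
  -- is taken at the right end point r ≥ u, so right continuity alone makes Φ tend to 0.
  let Φ : ℝ≥0 → ℝ≥0 → ℝ → ℝ := fun l r u => ρ l (A (x u.toNNReal)) - ρ u (A (x r))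
  have hb : ∀ s ∈ Set.Icc (a : ℝ) (a + d), ∀ t ≤ a + d, ‖ρ s (A (x t))‖ ≤ R * (‖A‖ * C) :=
    fun s hs t ht => ((ρ s).le_opNorm _).trans (mul_le_mul (hR s hs)
      ((A.le_opNorm _).trans (by gcongr; exact hC t ht)) (norm_nonneg _) hR0)
  have hconv := tendsto_sum_integral_gridPoint a d Φ (fun _ => 0)
    (R * (‖A‖ * C) + R * (‖A‖ * C))
    (fun l r => ((ρ l).continuous.measurable.comp hAm).sub
      (hρc.clm_apply continuous_const).measurable)
    (fun l r u h1 h2 h3 h4 => by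
      have h1' : (a : ℝ) ≤ l := h1
      have h4' : (r : ℝ) ≤ a + d := h4
      refine (norm_sub_le _ _).trans (add_le_add (hb _ ⟨h1', by linarith⟩ _ ?_)
        (hb _ ⟨by linarith, by linarith⟩ _ h4))
      exact Real.toNNReal_le_iff_le_coe.2 (h3.trans h4))
    (fun u h1 h2 l r h3 h4 h5 h6 h7 h8 => by
      have hu0 : (0 : ℝ) ≤ u := a.2.trans h1.le
      have hl : Tendsto (fun n => ρ (l n) (A (x u.toNNReal))) atTop (𝓝 (ρ u (A (x u.toNNReal)))) := by
        refine ((hρc.clm_apply continuous_const).tendsto u).comp ?_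
        rw [← NNReal.tendsto_coe] at h7
        simpa [hu0] using h7
      have hr : Tendsto (fun n => ρ u (A (x (r n)))) atTop (𝓝 (ρ u (A (x u.toNNReal)))) := by
        refine (((ρ u).comp A).continuous.tendsto _).comp ((hx u.toNNReal).1.tendsto.comp
          (tendsto_nhdsWithin_iff.2 ⟨h8, Eventually.of_forall fun n => ?_⟩))
        exact Real.toNNReal_le_iff_le_coe.2 (h5 n)
      simpa using hl.sub hr)
  have hxint : ∀ s t : ℝ≥0, s ≤ t → t ≤ a + d →
      IntervalIntegrable (fun u => A (x u.toNNReal)) volume s t := by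
    intro s t hst ht
    refine (intervalIntegrable_const (c := ‖A‖ * C)).mono_fun
      hAm.stronglyMeasurable.aestronglyMeasurable ?_
    refine (ae_restrict_iff' measurableSet_uIoc).2 (ae_of_all _ fun u hu => ?_)
    rw [Set.uIoc_of_le (by exact_mod_cast hst)] at hu
    refine ((A.le_opNorm _).trans ?_).trans (le_abs_self _)
    gcongr
    exact hC _ (Real.toNNReal_le_iff_le_coe.2 (hu.2.trans ht))
  have hstep : ∀ s t : ℝ≥0, a ≤ s → s ≤ t → t ≤ a + d →
      ρ s e * (ℓ t - ℓ s) = (ρ t (x t) - ρ s (x s)) - ∫ u in (s : ℝ)..(t : ℝ), Φ s t u := by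
    intro s t has hst ht
    have i1 : IntervalIntegrable (fun u : ℝ => ρ s (A (x u.toNNReal))) volume s t := by
      have := hxint s t hst ht
      exact ⟨(ρ s).integrable_comp this.1, (ρ s).integrable_comp this.2⟩
    have i2 : IntervalIntegrable (fun u : ℝ => ρ u (A (x t))) volume s t :=
      (hρc.clm_apply continuous_const).intervalIntegrable _ _
    have e1 : ∫ u in (s : ℝ)..(t : ℝ), ρ s (A (x u.toNNReal)) =
        ρ s (∫ u in (s : ℝ)..(t : ℝ), A (x u.toNNReal)) :=
      (ρ s).intervalIntegral_comp_comm (hxint s t hst ht)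
    have e2 : ∫ u in (s : ℝ)..(t : ℝ), -ρ u (A (x t)) = ρ t (x t) - ρ s (x t) :=
      intervalIntegral.integral_eq_sub_of_hasDerivAt (fun u _ => hρ u (x t)) i2.neg
    rw [intervalIntegral.integral_neg] at e2
    simp only [Φ]
    rw [intervalIntegral.integral_sub i1 i2, e1]
    have e3 := congrArg (ρ s) (hsde s t hst)
    simp only [map_add, map_smul, smul_eq_mul] at e3
    linarith
  have hcongr : ∀ n : ℕ, ∑ i ∈ Finset.range (n + 1), ρ (gridPoint a d n i) e *
      (ℓ (gridPoint a d n (i + 1)) - ℓ (gridPoint a d n i)) =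
      (ρ (a + d : ℝ≥0) (x (a + d)) - ρ a (x a)) - ∑ i ∈ Finset.range (n + 1),
        ∫ u in (gridPoint a d n i : ℝ)..(gridPoint a d n (i + 1) : ℝ),
          Φ (gridPoint a d n i) (gridPoint a d n (i + 1)) u := by
    intro n
    have ht := Finset.sum_range_sub
      (fun i => ρ (gridPoint a d n i) (x (gridPoint a d n i))) (n + 1)
    rw [gridPoint_zero, gridPoint_last] at ht
    rw [← ht, ← Finset.sum_sub_distrib]
    refine Finset.sum_congr rfl fun i hi => hstep _ _ (left_le_gridPoint ..)
      (gridPoint_mono _ _ _ (Nat.le_succ i)) (gridPoint_le_right _ _ ?_)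
    have := Finset.mem_range.1 hi
    omega
  simp_rw [hcongr]
  simpa using hconv.const_sub (ρ (a + d : ℝ≥0) (x (a + d)) - ρ a (x a))

/-! ### The functional v ↦ bᵀe^{Aτ}v and the kernel. -/

section MatrixExponential

variable {p : ℕ}

/-- The linear functional `v ↦ bᵀ e^{A τ} v`. -/
noncomputable def expFunctional (A : Matrix (Fin p) (Fin p) ℝ) (b : Fin p → ℝ) (τ : ℝ) :
    (Fin p → ℝ) →L[ℝ] ℝ :=
  LinearMap.toContinuousLinearMap
    ((dotProductBilin ℝ ℝ b) ∘ₗ (Matrix.mulVecLin (NormedSpace.exp (τ • A))))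

@[simp]
lemma expFunctional_apply (A : Matrix (Fin p) (Fin p) ℝ) (b v : Fin p → ℝ) (τ : ℝ) :
    expFunctional A b τ v = b ⬝ᵥ (NormedSpace.exp (τ • A) *ᵥ v) := rfl

attribute [local instance] Matrix.linftyOpNormedRing Matrix.linftyOpNormedAlgebra

lemma hasDerivAt_expFunctional (A : Matrix (Fin p) (Fin p) ℝ) (b v : Fin p → ℝ) (τ : ℝ) :
    HasDerivAt (fun τ => expFunctional A b τ v) (expFunctional A b τ (A *ᵥ v)) τ := by
  have h := hasDerivAt_exp_smul_const (𝕂 := ℝ) A τ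
  let f : Matrix (Fin p) (Fin p) ℝ →ₗ[ℝ] ℝ :=
    { toFun := fun M => b ⬝ᵥ (M *ᵥ v)
      map_add' := fun M N => by rw [add_mulVec, dotProduct_add]
      map_smul' := fun c M => by rw [smul_mulVec, dotProduct_smul]; rfl }
  have := (LinearMap.toContinuousLinearMap f).hasFDerivAt.comp_hasDerivAt τ h
  refine this.congr_deriv ?_
  rw [expFunctional_apply, mulVec_mulVec]
  rfl

lemma continuous_expFunctional (A : Matrix (Fin p) (Fin p) ℝ) (b : Fin p → ℝ) :
    Continuous (expFunctional A b) :=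
  continuous_clm_apply.2 fun v => continuous_iff_continuousAt.2 fun τ =>
    (hasDerivAt_expFunctional A b v τ).continuousAt

end MatrixExponential

/-- Since e^{Aᵀτ} is the transpose of e^{Aτ}, the middle matrix has rank one and its quadratic form
is a perfect square. This identifies g with c²/2, the exponent produced by a Gaussian integral. -/
lemma kernelSq_eq_sq {p : ℕ} (a b : Fin p → ℝ) (τ : ℝ) :
    kernelSq a b τ = (expFunctional (companion a) b τ (lastUnit p)) ^ 2 := by
  have h : NormedSpace.exp (τ • (companion a)ᵀ) = (NormedSpace.exp (τ • companion a))ᵀ := by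
    rw [← Matrix.exp_transpose, transpose_smul]
  rw [kernelSq, h, ← mulVec_mulVec, ← mulVec_mulVec, vecMulVec_mulVec, mulVec_transpose, mulVec_smul,
    dotProduct_smul]
  simp [pow_two, dotProduct_mulVec, dotProduct_comm]

/-- The increment of `bᵀ e^{A(T-u)} X_u` over `[t₀, T]`, `T = t₀ + d`, is the limit of the Riemann
sums of `bᵀ e^{A(T-u)} e` against the driving noise. -/
lemma tendsto_noise_sum {p : ℕ} {a b : Fin p → ℝ} {x : ℝ≥0 → Fin p → ℝ} {ℓ : ℝ≥0 → ℝ}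
    (hx : IsCadlagPath x)
    (hsde : ∀ s t : ℝ≥0, s ≤ t → x t = x s +
      (∫ u in (s : ℝ)..(t : ℝ), companion a *ᵥ x u.toNNReal) + (ℓ t - ℓ s) • lastUnit p)
    (t₀ d : ℝ≥0) :
    Tendsto (fun n : ℕ => ∑ i ∈ Finset.range (n + 1),
      expFunctional (companion a) b ((t₀ + d : ℝ≥0) - gridPoint t₀ d n i) (lastUnit p) *
        (ℓ (gridPoint t₀ d n (i + 1)) - ℓ (gridPoint t₀ d n i))) atTop
      (𝓝 (b ⬝ᵥ x (t₀ + d) - expFunctional (companion a) b d (x t₀))) := by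
  have := tendsto_sum_increments_of_linear_equation
    (A := LinearMap.toContinuousLinearMap (Matrix.mulVecLin (companion a))) (e := lastUnit p)
    (ρ := fun u => expFunctional (companion a) b ((t₀ + d : ℝ≥0) - u))
    ((continuous_expFunctional _ _).comp (by fun_prop))
    (fun u v => by
      have h := (hasDerivAt_expFunctional (companion a) b v ((t₀ + d : ℝ≥0) - u)).scomp u
        ((hasDerivAt_id u).const_sub ((t₀ + d : ℝ≥0) : ℝ))
      refine h.congr_deriv ?_
      simp) hx hsde t₀ d
  simpa [-expFunctional_apply, expFunctional] using this

/-! ### Independence of the noise from the past. -/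

section Independence

/-- On sets A ∩ B the two hypotheses factor the measure of A ∩ B ∩ C one after the other, and these
sets form a π-system generating `m₁ ⊔ m₂`. This lets independent increments be appended one at a
time. -/
lemma indep_sup_left_of_indep_sup_right {Ω : Type*} {m₁ m₂ m₃ mΩ : MeasurableSpace Ω}
    {Q : Measure Ω} [IsProbabilityMeasure Q] (h₁ : m₁ ≤ mΩ) (h₂ : m₂ ≤ mΩ) (h₃ : m₃ ≤ mΩ)
    (h : Indep m₁ (m₂ ⊔ m₃) Q) (h' : Indep m₂ m₃ Q) : Indep (m₁ ⊔ m₂) m₃ Q := by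
  let π : Set (Set Ω) := {s | ∃ A B, MeasurableSet[m₁] A ∧ MeasurableSet[m₂] B ∧ s = A ∩ B}
  have hgen : m₁ ⊔ m₂ = MeasurableSpace.generateFrom π := by
    refine le_antisymm (sup_le (fun A hA => ?_) fun B hB => ?_)
      (MeasurableSpace.generateFrom_le ?_)
    · exact MeasurableSpace.measurableSet_generateFrom
        ⟨A, Set.univ, hA, MeasurableSet.univ, by simp⟩
    · exact MeasurableSpace.measurableSet_generateFrom
        ⟨Set.univ, B, MeasurableSet.univ, hB, by simp⟩
    · rintro _ ⟨A, B, hA, hB, rfl⟩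
      exact ((le_sup_left : m₁ ≤ m₁ ⊔ m₂) _ hA).inter ((le_sup_right : m₂ ≤ m₁ ⊔ m₂) _ hB)
  have hpi : IsPiSystem π := by
    rintro _ ⟨A, B, hA, hB, rfl⟩ _ ⟨A', B', hA', hB', rfl⟩ -
    exact ⟨A ∩ A', B ∩ B', hA.inter hA', hB.inter hB', Set.inter_inter_inter_comm ..⟩
  refine IndepSets.indep (sup_le h₁ h₂) h₃ hpi (@MeasurableSpace.isPiSystem_measurableSet Ω m₃) hgen
    (@MeasurableSpace.generateFrom_measurableSet Ω m₃).symm ?_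
  rw [IndepSets_iff]
  rintro _ C ⟨A, B, hA, hB, rfl⟩ hC
  have hBC : MeasurableSet[m₂ ⊔ m₃] (B ∩ C) :=
    ((le_sup_left : m₂ ≤ m₂ ⊔ m₃) _ hB).inter ((le_sup_right : m₃ ≤ m₂ ⊔ m₃) _ hC)
  rw [Indep_iff] at h h'
  rw [Set.inter_assoc, h A _ hA hBC, h A B hA ((le_sup_left : m₂ ≤ m₂ ⊔ m₃) _ hB), h' B C hB hC,
    mul_assoc]

/-- A linear combination of increments of the driving noise over successive time intervals is
independent of the past of the first one. -/
lemma IsDrivingNoise.indep_sum_increments {Ω : Type*} {mΩ : MeasurableSpace Ω} {Q : Measure Ω}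
    [IsProbabilityMeasure Q] {ℱ : Filtration ℝ≥0 mΩ} {L : ℝ≥0 → Ω → ℝ}
    (hL : IsDrivingNoise Q ℱ L) (k : ℕ) {s : ℕ → ℝ≥0} (hs : Monotone s) (c : ℕ → ℝ) :
    Indep (MeasurableSpace.comap
      (fun ω => ∑ i ∈ Finset.range k, c i * (L (s (i + 1)) ω - L (s i) ω)) inferInstance)
      (ℱ (s 0)) Q := by
  induction k generalizing s c with
  | zero =>
    simp only [Finset.range_zero, Finset.sum_empty, MeasurableSpace.comap_const]
    exact indep_bot_left _
  | succ k ih =>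
    have hLm : ∀ t, Measurable (L t) := fun t => (hL.adapted t).mono (ℱ.le t) le_rfl
    -- The first increment is split off. The later ones are independent of `ℱ (s 1)`, which contains
    -- both that increment and `ℱ (s 0)`.
    have ih' := ih (s := fun i => s (i + 1)) (fun i j hij => hs (by omega)) (fun i => c (i + 1))
    set R : Ω → ℝ := fun ω => ∑ i ∈ Finset.range k,
      c (i + 1) * (L (s (i + 1 + 1)) ω - L (s (i + 1)) ω) with hR
    let D : Ω → ℝ := fun ω => L (s 1) ω - L (s 0) ω
    have hRm : Measurable R := by fun_prop
    have hDm : Measurable[ℱ (s 1)] D :=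
      (hL.adapted _).sub ((hL.adapted _).mono (ℱ.mono (hs zero_le_one)) le_rfl)
    have h := indep_sup_left_of_indep_sup_right hRm.comap_le
      ((hL.adapted _ |>.mono (ℱ.le _) le_rfl).sub (hLm (s 0)) |>.comap_le : _ ≤ mΩ)
      (ℱ.le (s 0)) (indep_of_indep_of_le_right ih' (sup_le hDm.comap_le (ℱ.mono (hs zero_le_one))))
      (hL.indep _ _ (hs zero_le_one))
    refine indep_of_indep_of_le_left h ?_
    rw [← measurable_iff_comap_le]
    simp only [Finset.sum_range_succ']
    refine Measurable.add (Measurable.of_comap_le le_sup_left) (Measurable.const_mul ?_ (c 0))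
    exact Measurable.of_comap_le (le_sup_right)

/-- An almost sure limit of random variables independent of a `σ`-algebra is independent of it. -/
lemma indep_comap_of_tendsto {Ω : Type*} {m mΩ : MeasurableSpace Ω} {Q : Measure Ω}
    [IsProbabilityMeasure Q] {Z : ℕ → Ω → ℝ} {Z' : Ω → ℝ}
    (hZ : ∀ n, Measurable (Z n)) (hZ' : Measurable Z')
    (hlim : ∀ᵐ ω ∂Q, Tendsto (fun n => Z n ω) atTop (𝓝 (Z' ω)))
    (hind : ∀ n, Indep (MeasurableSpace.comap (Z n) inferInstance) m Q) :
    Indep (MeasurableSpace.comap Z' inferInstance) m Q := by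
  rw [Indep_iff]
  rintro _ A ⟨B, hB, rfl⟩ hA
  -- Independence from A is rewritten as equality of two finite measures on ℝ. Bounded continuous
  -- functions decide it, and in that form it survives almost sure limits.
  have key : (Q.restrict A).map Z' = Q A • Q.map Z' := by
    have : IsFiniteMeasure (Q A • Q.map Z') :=
      ⟨by simp [Measure.map_apply hZ' MeasurableSet.univ]⟩
    refine ext_of_forall_integral_eq_of_IsFiniteMeasure fun f => ?_
    have hf : AEStronglyMeasurable (fun x => f x) (Q.map Z') :=
      f.continuous.aestronglyMeasurable
    rw [integral_map hZ'.aemeasurable f.continuous.aestronglyMeasurable, integral_smul_measure,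
      integral_map hZ'.aemeasurable hf]
    have lim : ∀ μ : Measure Ω, IsFiniteMeasure μ → μ ≪ Q →
        Tendsto (fun n => ∫ ω, f (Z n ω) ∂μ) atTop (𝓝 (∫ ω, f (Z' ω) ∂μ)) := by
      intro μ _ hμ
      refine tendsto_integral_of_dominated_convergence (fun _ => ‖f‖)
        (fun n => (f.continuous.measurable.comp (hZ n)).aestronglyMeasurable)
        (integrable_const _) (fun n => ae_of_all _ fun ω => f.norm_coe_le_norm _)
        (hμ.ae_le (hlim.mono fun ω hω => (f.continuous.tendsto _).comp hω))
    refine tendsto_nhds_unique (lim _ inferInstance Measure.restrict_le_self.absolutelyContinuous) ?_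
    refine ((lim Q inferInstance Measure.AbsolutelyContinuous.rfl).const_smul (Q A).toReal).congr
      fun n => ?_
    have hmap : (Q.restrict A).map (Z n) = Q A • Q.map (Z n) := by
      ext C hC
      rw [Measure.map_apply (hZ n) hC, Measure.restrict_apply (hZ n hC), Measure.smul_apply,
        Measure.map_apply (hZ n) hC, smul_eq_mul, mul_comm]
      exact (Indep_iff _ _ _).1 (hind n) _ _ ⟨C, hC, rfl⟩ hA
    have h1 := integral_map (μ := Q.restrict A) (hZ n).aemeasurable
      (f := f) f.continuous.aestronglyMeasurable
    have h2 := integral_map (μ := Q) (hZ n).aemeasurable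
      (f := f) f.continuous.aestronglyMeasurable
    rw [← h1, hmap, integral_smul_measure, h2]
  have := congrArg (fun μ => μ B) key
  simp only [Measure.map_apply hZ' hB, Measure.restrict_apply (hZ' hB), Measure.smul_apply,
    smul_eq_mul] at this
  rw [this, mul_comm]

end Independence

/-! ### Exponential moments of independent increments. -/

section IndependentIncrements

variable {Ω : Type*} {mΩ : MeasurableSpace Ω} {Q : Measure Ω}

/-- Stated in [0, ∞], so that no integrability is required; it serves both the Brownian motion and
the subordinator. -/
lemma lintegral_exp_sum_increments {X : ℝ≥0 → Ω → ℝ} (hX : HasIndepIncrements X Q)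
    (hXm : ∀ t, Measurable (X t)) {s : ℕ → ℝ≥0} (hs : Monotone s) (c : ℕ → ℝ) (n : ℕ) :
    ∫⁻ ω, ENNReal.ofReal (Real.exp (∑ i ∈ Finset.range n, c i * (X (s (i + 1)) ω - X (s i) ω))) ∂Q =
      ∏ i ∈ Finset.range n,
        ∫⁻ ω, ENNReal.ofReal (Real.exp (c i * (X (s (i + 1)) ω - X (s i) ω))) ∂Q := by
  have h := (hX.nat hs).comp (fun i x => ENNReal.ofReal (Real.exp (c i * x)))
    (fun i => by fun_prop)
  have := lintegral_prod_eq_prod_lintegral_of_indepFun (Finset.range n) _ h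
    (fun i => by simp only [Function.comp_def]; fun_prop)
  simp only [Function.comp_def] at this
  rw [← this]
  refine lintegral_congr fun ω => ?_
  rw [Real.exp_sum, ENNReal.ofReal_prod_of_nonneg fun i _ => (Real.exp_pos _).le]

lemma lintegral_exp_gaussian {Z : Ω → ℝ} {v : ℝ≥0} (hZ : HasLaw Z (gaussianReal 0 v) Q) (c : ℝ) :
    ∫⁻ ω, ENNReal.ofReal (Real.exp (c * Z ω)) ∂Q = ENNReal.ofReal (Real.exp (c ^ 2 / 2 * v)) := by
  have hint : Integrable (fun ω => Real.exp (c * Z ω)) Q := by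
    have := (integrable_map_measure (f := Z) (g := fun x => Real.exp (c * x)) (μ := Q)
      (by fun_prop) hZ.aemeasurable).1 (by rw [hZ.map_eq]; exact integrable_exp_mul_gaussianReal c)
    exact this
  rw [← ofReal_integral_eq_lintegral_ofReal hint (ae_of_all _ fun ω => (Real.exp_pos _).le)]
  have := mgf_gaussianReal hZ.map_eq c
  rw [mgf] at this
  rw [this]
  ring_nf

lemma IsPreBrownianReal.lintegral_exp_sum_increments {W : ℝ≥0 → Ω → ℝ}
    (hW : IsPreBrownianReal W Q) (hWm : ∀ t, Measurable (W t)) {s : ℕ → ℝ≥0} (hs : Monotone s)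
    (c : ℕ → ℝ) (n : ℕ) :
    ∫⁻ ω, ENNReal.ofReal (Real.exp (∑ i ∈ Finset.range n, c i * (W (s (i + 1)) ω - W (s i) ω))) ∂Q =
      ENNReal.ofReal (Real.exp (∑ i ∈ Finset.range n, c i ^ 2 / 2 * ((s (i + 1) : ℝ) - s i))) := by
  rw [TCBmCARMA.lintegral_exp_sum_increments hW.hasIndepIncrements hWm hs, Real.exp_sum,
    ENNReal.ofReal_prod_of_nonneg fun i _ => (Real.exp_pos _).le]
  refine Finset.prod_congr rfl fun i _ => ?_
  have h := lintegral_exp_gaussian (hW.hasLaw_sub (s (i + 1)) (s i)) (c i)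
  have hle : (s i : ℝ) ≤ s (i + 1) := hs (Nat.le_succ i)
  have e : (nndist (s (i + 1)).1 (s i).1 : ℝ) = (s (i + 1) : ℝ) - s i := by
    rw [coe_nndist, Real.dist_eq]
    exact abs_of_nonneg (sub_nonneg.2 hle)
  rw [e] at h
  exact h

end IndependentIncrements

/-! ### Conditioning on the clock. -/

section TimeChange

variable {Ω : Type*} {mΩ : MeasurableSpace Ω} {Q : Measure Ω}

/-- Tonelli for the product law: one of two independent variables may be frozen while the other is
integrated out. -/
lemma lintegral_comp_prodMk_of_indepFun [IsProbabilityMeasure Q] {E E' : Type*}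
    [MeasurableSpace E] [MeasurableSpace E'] {Y : Ω → E} {Z : Ω → E'} (hY : Measurable Y)
    (hZ : Measurable Z) (h : IndepFun Y Z Q) {G : E × E' → ℝ≥0∞} (hG : Measurable G) :
    ∫⁻ ω, G (Y ω, Z ω) ∂Q = ∫⁻ ω, ∫⁻ ω', G (Y ω, Z ω') ∂Q ∂Q := by
  rw [← lintegral_map hG (hY.prodMk hZ),
    (indepFun_iff_map_prod_eq_prod_map_map hY.aemeasurable hZ.aemeasurable).1 h,
    lintegral_prod _ hG.aemeasurable, lintegral_map hG.lintegral_prod_right' hY]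
  refine lintegral_congr fun ω => ?_
  rw [lintegral_map (by fun_prop) hZ]

/-- A process with almost surely continuous paths is indistinguishable from a measurable process
all of whose paths are continuous. -/
lemma exists_continuous_indistinguishable {W : ℝ≥0 → Ω → ℝ} (hWm : ∀ t, AEMeasurable (W t) Q)
    (hWc : ∀ᵐ ω ∂Q, Continuous fun t => W t ω) :
    ∃ W' : ℝ≥0 → Ω → ℝ, (∀ t, Measurable (W' t)) ∧ (∀ ω, Continuous fun t => W' t ω) ∧
      ∀ᵐ ω ∂Q, ∀ t, W t ω = W' t ω := by
  -- Measurable versions are used at countably many times only, so that their exceptional sets have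
  -- a null union; continuity recovers the other times.
  let q := TopologicalSpace.denseSeq ℝ≥0
  have hgood : ∀ᵐ ω ∂Q, Continuous (fun t => W t ω) ∧ ∀ k, W (q k) ω = (hWm (q k)).mk _ ω :=
    hWc.and (ae_all_iff.2 fun k => (hWm (q k)).ae_eq_mk)
  obtain ⟨N, hN, hNm, hN0⟩ := exists_measurable_superset_of_null (ae_iff.1 hgood)
  classical
  have hgood' : ∀ ω ∉ N, Continuous (fun t => W t ω) ∧ ∀ k, W (q k) ω = (hWm (q k)).mk _ ω := by
    intro ω hω
    by_contra h
    exact hω (hN h)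
  let W' : ℝ≥0 → Ω → ℝ := fun t => Nᶜ.indicator (W t)
  have hcont : ∀ ω, Continuous fun t => W' t ω := by
    intro ω
    by_cases hω : ω ∈ N
    · simpa [W', hω] using continuous_const
    · simpa [W', hω] using (hgood' ω hω).1
  have hq : ∀ k, Measurable (W' (q k)) := by
    intro k
    have : W' (q k) = Nᶜ.indicator ((hWm (q k)).mk _) := by
      funext ω
      by_cases hω : ω ∈ N
      · simp [W', hω]
      · simp [W', hω, (hgood' ω hω).2 k]
    rw [this]
    exact (hWm (q k)).measurable_mk.indicator hNm.compl
  refine ⟨W', fun t => ?_, hcont, ?_⟩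
  · obtain ⟨r, hr, hrt⟩ := mem_closure_iff_seq_limit.1
      (TopologicalSpace.denseRange_denseSeq ℝ≥0 t)
    choose k hk using hr
    refine measurable_of_tendsto_metrizable (f := fun n => W' (r n)) (fun n => ?_)
      (tendsto_pi_nhds.2 fun ω => ((hcont ω).tendsto t).comp hrt)
    rw [← hk n]
    exact hq _
  · filter_upwards [compl_mem_ae_iff.2 hN0] with ω hω t
    exact (Set.indicator_of_mem hω _).symm

/-- Conditionally on the time change, a linear combination of increments of the time-changed
Brownian motion is a centred Gaussian variable. -/
lemma lintegral_exp_sum_timeChange [IsProbabilityMeasure Q] {W : ℝ≥0 → Ω → ℝ}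
    {Λ : ℝ≥0 → Ω → ℝ≥0} (hW : IsBrownianReal W Q) (hΛ : IsSubordinator Q Λ)
    (hWΛ : IndepFun (fun ω t => W t ω) (fun ω t => Λ t ω) Q) {s : ℕ → ℝ≥0} (hs : Monotone s)
    (c : ℕ → ℝ) (n : ℕ) {φ : (ℝ≥0 → ℝ≥0) → ℝ≥0∞} (hφ : Measurable φ) :
    ∫⁻ ω, ENNReal.ofReal (Real.exp (∑ i ∈ Finset.range n,
        c i * (timeChange W Λ (s (i + 1)) ω - timeChange W Λ (s i) ω))) * φ (fun t => Λ t ω) ∂Q =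
      ∫⁻ ω, ENNReal.ofReal (Real.exp (∑ i ∈ Finset.range n,
        c i ^ 2 / 2 * ((Λ (s (i + 1)) ω : ℝ) - Λ (s i) ω))) * φ (fun t => Λ t ω) ∂Q := by
  obtain ⟨W', hm, hc, heq⟩ := exists_continuous_indistinguishable hW.aemeasurable hW.cont
  have hW' : IsPreBrownianReal W' Q :=
    hW.toIsPreBrownianReal.congr fun t => heq.mono fun ω hω => hω t
  -- On the space of continuous paths, evaluation (t, w) ↦ w t is jointly measurable, which makes W
  -- at the random time Λ_t a measurable function of the pair (Λ, Z).
  let Z : Ω → {w : ℝ≥0 → ℝ // Continuous w} := fun ω => ⟨fun t => W' t ω, hc ω⟩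
  have hZ : Measurable Z := (measurable_pi_lambda _ hm).subtype_mk
  have hY : Measurable fun ω t => Λ t ω := measurable_pi_lambda _ hΛ.measurable
  have hind : IndepFun (fun ω t => Λ t ω) Z Q := by
    have h : IndepFun (fun ω t => W' t ω) (fun ω t => Λ t ω) Q :=
      hWΛ.congr (heq.mono fun ω hω => funext hω) (ae_eq_refl _)
    have h' := h.symm
    rw [IndepFun_iff_Indep] at h' ⊢
    have : MeasurableSpace.comap Z inferInstance =
        MeasurableSpace.comap (fun ω t => W' t ω) inferInstance := by
      change MeasurableSpace.comap Z (MeasurableSpace.comap Subtype.val _) = _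
      rw [MeasurableSpace.comap_comp]
      rfl
    rwa [this]
  have heval : Measurable fun r : ℝ≥0 × {w : ℝ≥0 → ℝ // Continuous w} => r.2.1 r.1 :=
    measurable_uncurry_of_continuous_of_measurable
      (u := fun (t : ℝ≥0) (w : {w : ℝ≥0 → ℝ // Continuous w}) => w.1 t) (fun w => w.2)
      fun t => (measurable_pi_apply t).comp measurable_subtype_coe
  have hevalt : ∀ t : ℝ≥0, Measurable
      fun r : (ℝ≥0 → ℝ≥0) × {w : ℝ≥0 → ℝ // Continuous w} => r.2.1 (r.1 t) := fun t => by
    have h : Measurable fun r : (ℝ≥0 → ℝ≥0) × {w : ℝ≥0 → ℝ // Continuous w} => (r.1 t, r.2) := by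
      fun_prop
    exact heval.comp h
  have hG : Measurable fun r : (ℝ≥0 → ℝ≥0) × {w : ℝ≥0 → ℝ // Continuous w} =>
      ENNReal.ofReal (Real.exp (∑ i ∈ Finset.range n,
        c i * (r.2.1 (r.1 (s (i + 1))) - r.2.1 (r.1 (s i))))) * φ r.1 := by
    refine Measurable.mul (ENNReal.measurable_ofReal.comp (Real.measurable_exp.comp ?_))
      (hφ.comp measurable_fst)
    exact Finset.measurable_fun_sum _ fun i _ => ((hevalt _).sub (hevalt _)).const_mul _
  have key := lintegral_comp_prodMk_of_indepFun hY hZ hind hG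
  have e1 : ∫⁻ ω, ENNReal.ofReal (Real.exp (∑ i ∈ Finset.range n,
      c i * (timeChange W Λ (s (i + 1)) ω - timeChange W Λ (s i) ω))) * φ (fun t => Λ t ω) ∂Q =
      ∫⁻ ω, ENNReal.ofReal (Real.exp (∑ i ∈ Finset.range n,
        c i * (W' (Λ (s (i + 1)) ω) ω - W' (Λ (s i) ω) ω))) * φ (fun t => Λ t ω) ∂Q := by
    refine lintegral_congr_ae (heq.mono fun ω hω => ?_)
    simp only [timeChange, hω]
  rw [e1]
  refine key.trans (lintegral_congr_ae (hΛ.mono.mono fun ω hω => ?_))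
  simp only [Z]
  rw [lintegral_mul_const _ (by fun_prop)]
  congr 1
  -- With the clock frozen, the times Λ(s i) are deterministic and nondecreasing.
  exact IsPreBrownianReal.lintegral_exp_sum_increments hW' hm (s := fun i => Λ (s i) ω)
    (hω.comp hs) c n

end TimeChange

/-! ### Exponential moments of the subordinator. -/

section Subordinator

variable {Ω : Type*} {mΩ : MeasurableSpace Ω} {Q : Measure Ω}

/-- A monotone additive function on `[0, ∞)` is linear. -/
lemma eq_mul_of_monotone_of_additive {f : ℝ≥0 → ℝ} (hf : Monotone f)
    (hadd : ∀ s t, f (s + t) = f s + f t) (t : ℝ≥0) : f t = t * f 1 := by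
  have h0 : f 0 = 0 := by have := hadd 0 0; simp at this; exact this
  have hn : ∀ (n : ℕ) (s : ℝ≥0), f (n * s) = n * f s := by
    intro n s
    induction n with
    | zero => simp [h0]
    | succ n ih => push_cast; rw [add_mul, hadd, ih, one_mul, add_mul, one_mul]
  have h1 : 0 ≤ f 1 := h0 ▸ hf zero_le_one
  -- Comparing nt with the integers around it bounds n|f t - t f 1| by f 1 for every n, so the
  -- difference vanishes.
  have hbd : ∀ n : ℕ, |f t - t * f 1| * n ≤ f 1 := by
    intro n
    have a1 : (⌊n * t⌋₊ : ℝ) * f 1 ≤ n * f t := by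
      rw [← hn, ← hn, mul_one]
      exact hf (Nat.floor_le zero_le)
    have a2 : n * f t ≤ ((⌊n * t⌋₊ + 1 : ℕ) : ℝ) * f 1 := by
      rw [← hn, ← hn, mul_one]
      exact hf (by push_cast; exact (Nat.lt_floor_add_one _).le)
    have b1 : (⌊n * t⌋₊ : ℝ) ≤ n * t := by
      have := Nat.floor_le (zero_le (a := (n : ℝ≥0) * t))
      exact_mod_cast this
    have b2 : (n * t : ℝ) ≤ ⌊n * t⌋₊ + 1 := by
      have := (Nat.lt_floor_add_one ((n : ℝ≥0) * t)).le
      exact_mod_cast this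
    rw [← abs_of_nonneg (Nat.cast_nonneg (α := ℝ) n), ← abs_mul, abs_le]
    push_cast at a2
    constructor
    · nlinarith [mul_le_mul_of_nonneg_right b2 h1]
    · nlinarith [mul_le_mul_of_nonneg_right b1 h1]
  by_contra hne
  have hpos : 0 < |f t - t * f 1| := abs_pos.2 (sub_ne_zero.2 hne)
  obtain ⟨n, hn'⟩ := exists_nat_gt (f 1 / |f t - t * f 1|)
  rw [div_lt_iff₀ hpos] at hn'
  linarith [hbd n, mul_comm (n : ℝ) |f t - t * f 1|]

lemma IsSubordinator.lintegral_comp_increment {Λ : ℝ≥0 → Ω → ℝ≥0} (hΛ : IsSubordinator Q Λ)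
    (s t : ℝ≥0) {G : ℝ → ℝ≥0∞} (hG : Measurable G) :
    ∫⁻ ω, G ((Λ (s + t) ω : ℝ) - Λ s ω) ∂Q = ∫⁻ ω, G (Λ t ω) ∂Q := by
  have h := hΛ.stationary_increments s t
  rw [← lintegral_map' (f := G) hG.aemeasurable h.aemeasurable_fst, h.map_eq,
    lintegral_map' hG.aemeasurable h.aemeasurable_snd]

/-- The exponential moments of a subordinator: `E[exp (c Λ_t)] = exp (t k_Λ(c))`. -/
lemma IsSubordinator.lintegral_exp [IsProbabilityMeasure Q] {Λ : ℝ≥0 → Ω → ℝ≥0}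
    (hΛ : IsSubordinator Q Λ) {c : ℝ} (hc : 0 ≤ c)
    (hint : Integrable (fun ω => Real.exp (c * (Λ 1 ω : ℝ))) Q) (t : ℝ≥0) :
    ∫⁻ ω, ENNReal.ofReal (Real.exp (c * (Λ t ω : ℝ))) ∂Q =
      ENNReal.ofReal (Real.exp (t * cumulant Q Λ c)) := by
  let m : ℝ≥0 → ℝ≥0∞ := fun t => ∫⁻ ω, ENNReal.ofReal (Real.exp (c * (Λ t ω : ℝ))) ∂Q
  have hmul : ∀ s t, m (s + t) = m s * m t := by
    intro s t
    -- The times 0, s, s + t: independence and stationarity of the two increments make `m`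
    -- multiplicative. As `m` is also monotone, because c ≥ 0, its logarithm is linear.
    let τ : ℕ → ℝ≥0 := fun i => if i = 0 then 0 else if i = 1 then s else s + t
    have hτ : Monotone τ := monotone_nat_of_le_succ fun i => by
      rcases i with _ | _ | i <;> simp [τ]
    have h := lintegral_exp_sum_increments hΛ.indep_increments
      (fun t => (hΛ.measurable t).coe_nnreal_real) hτ (fun _ => c) 2
    simp only [Finset.sum_range_succ, Finset.prod_range_succ, Finset.sum_range_zero,
      Finset.prod_range_zero, one_mul, zero_add] at h
    simp only [τ] at h
    norm_num at h
    have z : ∀ r, ∫⁻ ω, ENNReal.ofReal (Real.exp (c * ((Λ r ω : ℝ) - Λ 0 ω))) ∂Q = m r :=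
      fun r => lintegral_congr_ae (hΛ.zero.mono fun ω hω => by simp [hω])
    rw [z, hΛ.lintegral_comp_increment s t
      (G := fun x => ENNReal.ofReal (Real.exp (c * x))) (by fun_prop)] at h
    rw [← h]
    refine lintegral_congr_ae (hΛ.zero.mono fun ω hω => ?_)
    simp only [hω]
    congr 2
    push_cast
    ring
  have hmono : Monotone m := fun s t hst => lintegral_mono_ae (hΛ.mono.mono fun ω hω => by
    have : (Λ s ω : ℝ) ≤ Λ t ω := NNReal.coe_le_coe.2 (hω hst)
    gcongr)
  have hone : ∀ t, 1 ≤ m t := fun t => by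
    have : ∫⁻ _, 1 ∂Q ≤ m t := lintegral_mono fun ω => by
      rw [ENNReal.one_le_ofReal, Real.one_le_exp_iff]; positivity
    simpa using this
  have hm1 : m 1 = ENNReal.ofReal (mgf (fun ω => (Λ 1 ω : ℝ)) Q c) :=
    (ofReal_integral_eq_lintegral_ofReal hint (ae_of_all _ fun ω => (Real.exp_pos _).le)).symm
  have hnat : ∀ n : ℕ, m n ≠ ∞ := by
    intro n
    induction n with
    | zero =>
      have : m 0 = 1 := by
        have : m 0 = ∫⁻ _, 1 ∂Q :=
          lintegral_congr_ae (hΛ.zero.mono fun ω hω => by simp [hω])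
        simpa using this
      simp [this]
    | succ n ih =>
      push_cast
      rw [hmul]
      exact ENNReal.mul_ne_top ih (by rw [hm1]; exact ENNReal.ofReal_ne_top)
  have htop : ∀ t, m t ≠ ∞ := fun t => by
    obtain ⟨n, hn⟩ := exists_nat_ge t
    exact ne_top_of_le_ne_top (hnat n) (hmono hn)
  have hpos : ∀ t, 0 < (m t).toReal := fun t =>
    ENNReal.toReal_pos (zero_lt_one.trans_le (hone t)).ne' (htop t)
  have hlin := eq_mul_of_monotone_of_additive (f := fun t => Real.log (m t).toReal)
    (fun s t hst => Real.log_le_log (hpos s) (ENNReal.toReal_mono (htop t) (hmono hst)))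
    (fun s t => by
      simp only [hmul, ENNReal.toReal_mul]
      exact Real.log_mul (hpos s).ne' (hpos t).ne') t
  have hcgf : Real.log (m 1).toReal = cumulant Q Λ c := by
    rw [hm1, ENNReal.toReal_ofReal mgf_nonneg]
    rfl
  rw [← hcgf, ← hlin, Real.exp_log (hpos t), ENNReal.ofReal_toReal (htop t)]

end Subordinator

/-! ### Interchanging limit and expectation. -/

/-- Convergence of expectations from almost sure convergence and uniformly small tails. -/
lemma tendsto_lintegral_of_uniform_tail {Ω : Type*} {mΩ : MeasurableSpace Ω} {Q : Measure Ω}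
    [IsFiniteMeasure Q] {f : ℕ → Ω → ℝ≥0∞} {F : Ω → ℝ≥0∞} (hf : ∀ n, Measurable (f n))
    (hlim : ∀ᵐ ω ∂Q, Tendsto (fun n => f n ω) atTop (𝓝 (F ω)))
    (htail : ∀ ε : ℝ≥0∞, 0 < ε → ∃ R : ℝ≥0, ∀ n, ∫⁻ ω, (f n ω - R) ∂Q ≤ ε) :
    Tendsto (fun n => ∫⁻ ω, f n ω ∂Q) atTop (𝓝 (∫⁻ ω, F ω ∂Q)) := by
  refine tendsto_of_le_liminf_of_limsup_le ?_ ?_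
  · calc ∫⁻ ω, F ω ∂Q = ∫⁻ ω, liminf (fun n => f n ω) atTop ∂Q :=
          lintegral_congr_ae (hlim.mono fun ω hω => hω.liminf_eq.symm)
      _ ≤ _ := lintegral_liminf_le hf
  · refine ENNReal.le_of_forall_pos_le_add fun ε hε _ => ?_
    obtain ⟨R, hR⟩ := htail ε (by exact_mod_cast hε)
    have h1 : Tendsto (fun n => ∫⁻ ω, min (f n ω) R ∂Q) atTop (𝓝 (∫⁻ ω, min (F ω) R ∂Q)) := by
      refine tendsto_lintegral_of_dominated_convergence (fun _ => (R : ℝ≥0∞))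
        (fun n => (hf n).min measurable_const) (fun n => ae_of_all _ fun ω => min_le_right _ _)
        (by simpa using ENNReal.mul_ne_top ENNReal.coe_ne_top (measure_ne_top Q _))
        (hlim.mono fun ω hω => hω.min tendsto_const_nhds)
    have h2 : ∀ n, ∫⁻ ω, f n ω ∂Q ≤ ∫⁻ ω, min (f n ω) R ∂Q + ε := by
      intro n
      calc ∫⁻ ω, f n ω ∂Q = ∫⁻ ω, (min (f n ω) R + (f n ω - R)) ∂Q :=
            lintegral_congr fun ω => by
              rcases le_total (f n ω) R with h | h
              · rw [min_eq_left h, tsub_eq_zero_of_le h, add_zero]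
              · rw [min_eq_right h, add_tsub_cancel_of_le h]
        _ = _ := lintegral_add_left ((hf n).min measurable_const) _
        _ ≤ _ := by gcongr; exact hR n
    calc limsup (fun n => ∫⁻ ω, f n ω ∂Q) atTop
        ≤ limsup (fun n => ∫⁻ ω, min (f n ω) R ∂Q + ε) atTop :=
          limsup_le_limsup (Eventually.of_forall h2)
      _ = ∫⁻ ω, min (F ω) R ∂Q + ε := (h1.add tendsto_const_nhds).limsup_eq
      _ ≤ _ := by gcongr; exact min_le_left _ _

/-- Expectations of exponentials of linear combinations of increments of the time-changed
Brownian motion converge along refining partitions, if the subordinator has an exponential moment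
that dominates all the coefficients. -/
lemma tendsto_lintegral_exp_sum_timeChange {Ω : Type*} {mΩ : MeasurableSpace Ω} {Q : Measure Ω}
    [IsProbabilityMeasure Q] {W : ℝ≥0 → Ω → ℝ} {Λ : ℝ≥0 → Ω → ℝ≥0} (hW : IsBrownianReal W Q)
    (hΛ : IsSubordinator Q Λ) (hWΛ : IndepFun (fun ω t => W t ω) (fun ω t => Λ t ω) Q)
    (hLm : ∀ t, Measurable (timeChange W Λ t)) {t₀ d : ℝ≥0} {c : ℕ → ℕ → ℝ} {v : ℝ}
    (hc : ∀ n, ∀ i ≤ n, c n i ^ 2 / 2 ≤ v)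
    (hv : Integrable (fun ω => Real.exp (v * (Λ 1 ω : ℝ))) Q) {J : Ω → ℝ}
    (hJ : ∀ᵐ ω ∂Q, Tendsto (fun n => ∑ i ∈ Finset.range (n + 1), c n i *
      (timeChange W Λ (gridPoint t₀ d n (i + 1)) ω - timeChange W Λ (gridPoint t₀ d n i) ω))
      atTop (𝓝 (J ω))) :
    Tendsto (fun n => ∫⁻ ω, ENNReal.ofReal (Real.exp (∑ i ∈ Finset.range (n + 1), c n i *
      (timeChange W Λ (gridPoint t₀ d n (i + 1)) ω - timeChange W Λ (gridPoint t₀ d n i) ω))) ∂Q)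
      atTop (𝓝 (∫⁻ ω, ENNReal.ofReal (Real.exp (J ω)) ∂Q)) := by
  set Jn : ℕ → Ω → ℝ := fun n ω => ∑ i ∈ Finset.range (n + 1), c n i *
      (timeChange W Λ (gridPoint t₀ d n (i + 1)) ω - timeChange W Λ (gridPoint t₀ d n i) ω)
  have hJm : ∀ n, Measurable (Jn n) := fun n => by fun_prop
  have hv0 : 0 ≤ v := (by positivity : 0 ≤ c 0 0 ^ 2 / 2).trans (hc 0 0 le_rfl)
  let M : (ℝ≥0 → ℝ≥0) → ℝ := fun l => (l (t₀ + d) : ℝ) - l t₀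
  have hMm : Measurable M := by fun_prop
  have hΛm : Measurable fun ω t => Λ t ω := measurable_pi_lambda _ hΛ.measurable
  have hMΛ : Measurable fun ω => M fun t => Λ t ω := hMm.comp hΛm
  have hMint : ∫⁻ ω, ENNReal.ofReal (Real.exp (v * M fun t => Λ t ω)) ∂Q ≠ ∞ := by
    rw [hΛ.lintegral_comp_increment t₀ d (G := fun x => ENNReal.ofReal (Real.exp (v * x)))
      (by fun_prop), hΛ.lintegral_exp hv0 hv]
    exact ENNReal.ofReal_ne_top
  have hsum : ∀ᵐ ω ∂Q, ∀ n, ∑ i ∈ Finset.range (n + 1), c n i ^ 2 / 2 *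
      ((Λ (gridPoint t₀ d n (i + 1)) ω : ℝ) - Λ (gridPoint t₀ d n i) ω) ≤ v * M fun t => Λ t ω := by
    filter_upwards [hΛ.mono] with ω hω n
    have ht := Finset.sum_range_sub (fun i => (Λ (gridPoint t₀ d n i) ω : ℝ)) (n + 1)
    rw [gridPoint_zero, gridPoint_last] at ht
    simp only [M]
    rw [← ht, Finset.mul_sum]
    refine Finset.sum_le_sum fun i hi => mul_le_mul_of_nonneg_right
      (hc n i (by have := Finset.mem_range.1 hi; omega)) (sub_nonneg.2 ?_)
    exact NNReal.coe_le_coe.2 (hω (gridPoint_mono _ _ _ (Nat.le_succ i)))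
  refine tendsto_lintegral_of_uniform_tail (fun n => by fun_prop)
    (hJ.mono fun ω hω => ENNReal.tendsto_ofReal ((Real.continuous_exp.tendsto _).comp hω))
    fun ε hε => ?_
  -- the part of the expectation on the event that the time change increases a lot
  obtain ⟨K, hK⟩ : ∃ K : ℕ, ∫⁻ ω, ENNReal.ofReal (Real.exp (v * M fun t => Λ t ω)) *
      {l | (K : ℝ) < M l}.indicator 1 (fun t => Λ t ω) ∂Q ≤ ε / 2 := by
    have h : Tendsto (fun K : ℕ => ∫⁻ ω, ENNReal.ofReal (Real.exp (v * M fun t => Λ t ω)) *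
        {l | (K : ℝ) < M l}.indicator 1 (fun t => Λ t ω) ∂Q) atTop (𝓝 (∫⁻ _, 0 ∂Q)) := by
      refine tendsto_lintegral_of_dominated_convergence
        (fun ω => ENNReal.ofReal (Real.exp (v * M fun t => Λ t ω))) (fun K => ?_)
        (fun K => ae_of_all _ fun ω => ?_) hMint (ae_of_all _ fun ω => ?_)
      · have : Measurable ({l | (K : ℝ) < M l}.indicator (1 : (ℝ≥0 → ℝ≥0) → ℝ≥0∞)) :=
          measurable_one.indicator (measurableSet_lt measurable_const hMm)
        exact (hMΛ.const_mul v).exp.ennreal_ofReal.mul (this.comp hΛm)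
      · refine mul_le_of_le_one_right' ?_
        exact Set.indicator_le_self' (fun _ _ => zero_le) _
      · obtain ⟨k, hk⟩ := exists_nat_ge (M fun t => Λ t ω)
        refine tendsto_const_nhds.congr' ((eventually_ge_atTop k).mono fun n hn => ?_)
        have : (fun t => Λ t ω) ∉ {l | (n : ℝ) < M l} := not_lt.2 (hk.trans (by exact_mod_cast hn))
        simp only [Set.indicator_of_notMem this, mul_zero]
    rw [lintegral_zero] at h
    exact ((h.eventually_lt_const (ENNReal.half_pos hε.ne')).exists).imp fun K hK => hK.le
  -- Doubling the coefficients multiplies cᵢ²/2 by 4, whence the bound e^{4vK} for the second moment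
  -- on M ≤ K.
  obtain ⟨R, hR0, hR⟩ : ∃ R : ℝ≥0, 0 < R ∧
      ENNReal.ofReal (Real.exp (4 * v * K)) * (R : ℝ≥0∞)⁻¹ ≤ ε / 2 := by
    have h : Tendsto (fun n : ℕ => ENNReal.ofReal (Real.exp (4 * v * K)) * (n : ℝ≥0∞)⁻¹) atTop
        (𝓝 (ENNReal.ofReal (Real.exp (4 * v * K)) * 0)) :=
      ENNReal.Tendsto.const_mul ENNReal.tendsto_inv_nat_nhds_zero (Or.inr ENNReal.ofReal_ne_top)
    rw [mul_zero] at h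
    obtain ⟨n, hn1, hn2⟩ := ((h.eventually_lt_const (ENNReal.half_pos hε.ne')).and
      (eventually_gt_atTop 0)).exists
    exact ⟨n, by exact_mod_cast hn2, by simpa using hn1.le⟩
  refine ⟨R, fun n => ?_⟩
  let A : Set (ℝ≥0 → ℝ≥0) := {l | (K : ℝ) < M l}
  have hA : MeasurableSet A := measurableSet_lt measurable_const hMm
  have hφ : Measurable (A.indicator (1 : (ℝ≥0 → ℝ≥0) → ℝ≥0∞)) := measurable_one.indicator hA
  have hψ : Measurable (Aᶜ.indicator (1 : (ℝ≥0 → ℝ≥0) → ℝ≥0∞)) := measurable_one.indicator hA.compl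
  -- With y = e^{Jₙ}, the excess (y - R)⁺ is at most y on M > K and at most y²/R elsewhere. The
  -- exponential with coefficients 2cᵢ is y².
  have hpt : ∀ ω, ENNReal.ofReal (Real.exp (Jn n ω)) - R ≤
      ENNReal.ofReal (Real.exp (Jn n ω)) * A.indicator 1 (fun t => Λ t ω) +
      ENNReal.ofReal (Real.exp (∑ i ∈ Finset.range (n + 1), (2 * c n i) *
        (timeChange W Λ (gridPoint t₀ d n (i + 1)) ω -
          timeChange W Λ (gridPoint t₀ d n i) ω))) * Aᶜ.indicator 1 (fun t => Λ t ω) *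
        (R : ℝ≥0∞)⁻¹ := by
    intro ω
    have h2 : ∑ i ∈ Finset.range (n + 1), (2 * c n i) *
        (timeChange W Λ (gridPoint t₀ d n (i + 1)) ω -
          timeChange W Λ (gridPoint t₀ d n i) ω) = Jn n ω + Jn n ω := by
      simp only [Jn]
      rw [← two_mul, Finset.mul_sum]
      exact Finset.sum_congr rfl fun i _ => by ring
    rw [h2, Real.exp_add, ENNReal.ofReal_mul (Real.exp_pos _).le]
    by_cases hω : (fun t => Λ t ω) ∈ A
    · simp [hω]
    · simp only [hω, not_false_eq_true, Set.indicator_of_notMem, mul_zero, zero_add,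
        Set.indicator_of_mem, Set.mem_compl_iff, Pi.one_apply, mul_one]
      set y := ENNReal.ofReal (Real.exp (Jn n ω))
      rcases le_total y R with h | h
      · simp [tsub_eq_zero_of_le h]
      · refine tsub_le_self.trans ?_
        have hRne : (R : ℝ≥0∞) ≠ 0 := by exact_mod_cast hR0.ne'
        rw [mul_assoc, ← div_eq_mul_inv]
        exact le_mul_of_one_le_right' ((ENNReal.le_div_iff_mul_le (Or.inl hRne)
          (Or.inl ENNReal.coe_ne_top)).2 (by simpa using h))
  have hφΛ : Measurable fun ω => A.indicator (1 : (ℝ≥0 → ℝ≥0) → ℝ≥0∞) fun t => Λ t ω :=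
    hφ.comp hΛm
  have hψΛ : Measurable fun ω => Aᶜ.indicator (1 : (ℝ≥0 → ℝ≥0) → ℝ≥0∞) fun t => Λ t ω :=
    hψ.comp hΛm
  refine (lintegral_mono hpt).trans ?_
  have hmono := gridPoint_mono t₀ d n
  rw [lintegral_add_left (Measurable.fun_mul (by fun_prop) hφΛ),
    lintegral_mul_const _ (Measurable.fun_mul (by fun_prop) hψΛ),
    lintegral_exp_sum_timeChange hW hΛ hWΛ hmono (c n) (n + 1) hφ,
    lintegral_exp_sum_timeChange hW hΛ hWΛ hmono (fun i => 2 * c n i) (n + 1) hψ,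
    ← ENNReal.add_halves ε]
  refine add_le_add ((lintegral_mono_ae ?_).trans hK) (le_trans ?_ hR)
  · filter_upwards [hsum] with ω hω
    gcongr
    exact hω n
  · gcongr
    calc _ ≤ ∫⁻ _, ENNReal.ofReal (Real.exp (4 * v * K)) ∂Q := lintegral_mono_ae ?_
      _ = _ := by simp
    filter_upwards [hsum] with ω hω
    by_cases hωA : (fun t => Λ t ω) ∈ A
    · simp [hωA]
    · simp only [hωA, not_false_eq_true, Set.indicator_of_mem, Set.mem_compl_iff, Pi.one_apply,
        mul_one]
      gcongr
      have hle : M (fun t => Λ t ω) ≤ K := not_lt.1 hωA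
      calc ∑ i ∈ Finset.range (n + 1), (2 * c n i) ^ 2 / 2 *
            ((Λ (gridPoint t₀ d n (i + 1)) ω : ℝ) - Λ (gridPoint t₀ d n i) ω)
          = 4 * ∑ i ∈ Finset.range (n + 1), c n i ^ 2 / 2 *
            ((Λ (gridPoint t₀ d n (i + 1)) ω : ℝ) - Λ (gridPoint t₀ d n i) ω) := by
            rw [Finset.mul_sum]
            exact Finset.sum_congr rfl fun i _ => by ring
        _ ≤ 4 * (v * M fun t => Λ t ω) := by gcongr; exact hω n
        _ ≤ 4 * (v * K) := by gcongr
        _ = 4 * v * K := by ring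

/-! ### The conditional expectation and the formula. -/

section FuturesPrice

variable {Ω : Type*} {mΩ : MeasurableSpace Ω} {Q : Measure Ω}

lemma integrable_exp_of_le {Λ : ℝ≥0 → Ω → ℝ≥0} (hΛ : Measurable (Λ 1)) {c v : ℝ} (hcv : c ≤ v)
    (hv : Integrable (fun ω => Real.exp (v * (Λ 1 ω : ℝ))) Q) :
    Integrable (fun ω => Real.exp (c * (Λ 1 ω : ℝ))) Q :=
  hv.mono' (by fun_prop) (ae_of_all _ fun ω => by
    rw [Real.norm_eq_abs, Real.abs_exp]; gcongr)

/-- As Λ₁ ≥ 0, e^{vΛ₁} dominates all the smaller exponents. Dominated convergence thus gives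
continuity up to v itself, beyond which the moment generating function may be infinite. -/
lemma continuousOn_cumulant_comp [IsProbabilityMeasure Q] {Λ : ℝ≥0 → Ω → ℝ≥0}
    (hΛ : Measurable (Λ 1)) {g : ℝ → ℝ} {s : Set ℝ} (hg : ContinuousOn g s) {v : ℝ}
    (hgv : ∀ u ∈ s, g u ≤ v) (hv : Integrable (fun ω => Real.exp (v * (Λ 1 ω : ℝ))) Q) :
    ContinuousOn (fun u => cumulant Q Λ (g u)) s := by
  refine ContinuousOn.log (f := fun u => mgf (fun ω => (Λ 1 ω : ℝ)) Q (g u)) ?_ fun u hu =>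
    (mgf_pos (integrable_exp_of_le hΛ (hgv u hu) hv)).ne'
  refine continuousOn_of_dominated (bound := fun ω => Real.exp (v * (Λ 1 ω : ℝ)))
    (fun u _ => by fun_prop) (fun u hu => ae_of_all _ fun ω => ?_) hv (ae_of_all _ fun ω => ?_)
  · have := hgv u hu
    rw [Real.norm_eq_abs, Real.abs_exp]
    gcongr
  · exact Real.continuous_exp.comp_continuousOn (hg.mul continuousOn_const)

/-- The exponential moment of the stochastic integral of a deterministic continuous function
against the time-changed Brownian motion. -/
lemma lintegral_exp_noise_limit [IsProbabilityMeasure Q] {W : ℝ≥0 → Ω → ℝ} {Λ : ℝ≥0 → Ω → ℝ≥0}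
    (hW : IsBrownianReal W Q) (hΛ : IsSubordinator Q Λ)
    (hWΛ : IndepFun (fun ω t => W t ω) (fun ω t => Λ t ω) Q)
    (hLm : ∀ t, Measurable (timeChange W Λ t)) {t₀ d : ℝ≥0} {c : ℝ → ℝ} (hc : Continuous c) {v : ℝ}
    (hcv : ∀ u ∈ Set.Icc (t₀ : ℝ) (t₀ + d), c u ^ 2 / 2 ≤ v)
    (hv : Integrable (fun ω => Real.exp (v * (Λ 1 ω : ℝ))) Q) {J : Ω → ℝ}
    (hJ : ∀ᵐ ω ∂Q, Tendsto (fun n => ∑ i ∈ Finset.range (n + 1), c (gridPoint t₀ d n i) *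
      (timeChange W Λ (gridPoint t₀ d n (i + 1)) ω - timeChange W Λ (gridPoint t₀ d n i) ω))
      atTop (𝓝 (J ω))) :
    ∫⁻ ω, ENNReal.ofReal (Real.exp (J ω)) ∂Q =
      ENNReal.ofReal (Real.exp (∫ u in (t₀ : ℝ)..(t₀ + d : ℝ), cumulant Q Λ (c u ^ 2 / 2))) := by
  have hgrid : ∀ n, ∀ i ≤ n, c (gridPoint t₀ d n i) ^ 2 / 2 ≤ v := fun n i hi =>
    hcv _ ⟨NNReal.coe_le_coe.2 (left_le_gridPoint t₀ d n i), by
      rw [← NNReal.coe_add]; exact NNReal.coe_le_coe.2 (gridPoint_le_right t₀ d (by omega))⟩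
  have hlim := tendsto_lintegral_exp_sum_timeChange hW hΛ hWΛ hLm
    (c := fun n i => c (gridPoint t₀ d n i)) hgrid hv hJ
  refine tendsto_nhds_unique hlim ?_
  have hcont : ContinuousOn (fun u => cumulant Q Λ (c u ^ 2 / 2))
      (Set.Icc (t₀ : ℝ) (t₀ + d)) :=
    continuousOn_cumulant_comp (hΛ.measurable 1) (g := fun u => c u ^ 2 / 2)
      (by fun_prop) hcv hv
  refine (ENNReal.tendsto_ofReal ((Real.continuous_exp.tendsto _).comp
    (tendsto_riemannSum t₀ d _ hcont))).congr fun n => ?_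
  have h := lintegral_exp_sum_timeChange hW hΛ hWΛ (gridPoint_mono t₀ d n)
    (fun i => c (gridPoint t₀ d n i)) (n + 1) (φ := fun _ => 1) measurable_const
  simp only [mul_one] at h
  rw [h, lintegral_exp_sum_increments hΛ.indep_increments
    (fun t => (hΛ.measurable t).coe_nnreal_real) (gridPoint_mono t₀ d n)
    (fun i => c (gridPoint t₀ d n i) ^ 2 / 2), Function.comp_apply, Real.exp_sum,
    ENNReal.ofReal_prod_of_nonneg fun i _ => (Real.exp_pos _).le]
  refine Finset.prod_congr rfl fun i hi => ?_
  rw [gridPoint_succ, hΛ.lintegral_comp_increment _ _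
    (G := fun x => ENNReal.ofReal (Real.exp (c (gridPoint t₀ d n i) ^ 2 / 2 * x))) (by fun_prop),
    hΛ.lintegral_exp (by positivity) (integrable_exp_of_le (hΛ.measurable 1)
      (hgrid n i (by have := Finset.mem_range.1 hi; omega)) hv)]
  simp

/-- Factors measurable with respect to the conditioning `σ`-algebra are taken out of the
conditional expectation, and an independent factor is replaced by its expectation. -/
lemma condLExp_mul_of_indep [IsProbabilityMeasure Q] {m : MeasurableSpace Ω} (hm : m ≤ mΩ)
    {G H : Ω → ℝ≥0∞} (hG : Measurable[m] G) (hH : Measurable[mΩ] H)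
    (hind : Indep (MeasurableSpace.comap H inferInstance) m Q) :
    condLExp m Q (fun ω => G ω * H ω) =ᵐ[Q] fun ω => G ω * ∫⁻ ω', H ω' ∂Q := by
  refine (ae_eq_condLExp hm Q _ (hG.mul_const _) fun s hs => ?_).symm
  have hsG : Measurable[m] (s.indicator G) := hG.indicator hs
  rw [← lintegral_indicator (hm s hs), ← lintegral_indicator (hm s hs)]
  have h := lintegral_mul_eq_lintegral_mul_lintegral_of_independent_measurableSpace hm
    hH.comap_le hind.symm hsG (Measurable.of_comap_le le_rfl)
  simp_rw [Set.indicator_mul_left]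
  rw [h, lintegral_mul_const _ (hsG.mono hm le_rfl)]

end FuturesPrice

end TCBmCARMA

theorem mainTheorem2 {Ω : Type*} {mΩ : MeasurableSpace Ω} (Q : Measure Ω) [IsProbabilityMeasure Q]
    (ℱ : Filtration ℝ≥0 mΩ)
    -- Brownian motion and an independent subordinator
    (W : ℝ≥0 → Ω → ℝ) (Λ : ℝ≥0 → Ω → ℝ≥0)
    (hW : IsBrownianReal W Q) (hΛ : TCBmCARMA.IsSubordinator Q Λ)
    (hWΛ : IndepFun (fun ω t => W t ω) (fun ω t => Λ t ω) Q)
    (hL : TCBmCARMA.IsDrivingNoise Q ℱ (TCBmCARMA.timeChange W Λ))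
    -- CARMA(p,q) coefficients and state process
    (p q : ℕ) (hqp : q < p) (a b : Fin p → ℝ) (hb : ∀ j : Fin p, q < (j : ℕ) → b j = 0)
    (X : ℝ≥0 → Ω → (Fin p → ℝ))
    (hX : TCBmCARMA.IsCARMAState Q ℱ a (TCBmCARMA.timeChange W Λ) X)
    -- spot price
    (t₀ T : ℝ≥0) (hT : t₀ ≤ T) (S : ℝ≥0 → Ω → ℝ)
    (hS_adapted : ∀ t, Measurable[ℱ t] (S t)) (hS_pos : ∀ᵐ ω ∂Q, 0 < S t₀ ω)
    (hS : ∀ᵐ ω ∂Q, S T ω = S t₀ ω * Real.exp (b ⬝ᵥ X T ω))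
    -- `k_Λ` is finite at every argument at which the formula evaluates it
    (hk : ∀ u ∈ Set.Icc (t₀ : ℝ) T, Integrable
      (fun ω => Real.exp ((1 / 2 * TCBmCARMA.kernelSq a b (T - u)) * (Λ 1 ω : ℝ))) Q) :
    IntervalIntegrable
        (fun u : ℝ => TCBmCARMA.cumulant Q Λ (1 / 2 * TCBmCARMA.kernelSq a b (T - u)))
        volume t₀ T ∧
      (∀ᵐ ω ∂Q, 0 < TCBmCARMA.futuresPrice Q ℱ S t₀ T ω ∧
        TCBmCARMA.futuresPrice Q ℱ S t₀ T ω < ∞ ∧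
        Real.log (TCBmCARMA.futuresPrice Q ℱ S t₀ T ω).toReal =
          Real.log (S t₀ ω)
            + b ⬝ᵥ (NormedSpace.exp (((T : ℝ) - t₀) • TCBmCARMA.companion a) *ᵥ X t₀ ω)
            + ∫ u in (t₀ : ℝ)..T,
                TCBmCARMA.cumulant Q Λ (1 / 2 * TCBmCARMA.kernelSq a b (T - u))) ∧
      -- the same formula for the conditional expectation of an integrable `S_T`
      (Integrable (S T) Q → ∀ᵐ ω ∂Q, 0 < (Q[S T | ℱ t₀]) ω ∧
        Real.log ((Q[S T | ℱ t₀]) ω) =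
          Real.log (S t₀ ω)
            + b ⬝ᵥ (NormedSpace.exp (((T : ℝ) - t₀) • TCBmCARMA.companion a) *ᵥ X t₀ ω)
            + ∫ u in (t₀ : ℝ)..T,
                TCBmCARMA.cumulant Q Λ (1 / 2 * TCBmCARMA.kernelSq a b (T - u))) := by
  obtain ⟨d, rfl⟩ := exists_add_of_le hT
  have hLm : ∀ t, Measurable (TCBmCARMA.timeChange W Λ t) := fun t =>
    (hL.adapted t).mono (ℱ.le t) le_rfl
  have hXm : ∀ t, Measurable (X t) := fun t => (hX.adapted t).mono (ℱ.le t) le_rfl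
  let c : ℝ → ℝ := fun u => TCBmCARMA.expFunctional (TCBmCARMA.companion a) b
    ((t₀ + d : ℝ≥0) - u) (TCBmCARMA.lastUnit p)
  have hc : Continuous c :=
    ((TCBmCARMA.continuous_expFunctional _ _).comp (by fun_prop)).clm_apply continuous_const
  have hg : ∀ u : ℝ, 1 / 2 * TCBmCARMA.kernelSq a b ((t₀ + d : ℝ≥0) - u) = c u ^ 2 / 2 := fun u => by
    rw [TCBmCARMA.kernelSq_eq_sq]
    ring
  simp only [hg] at hk ⊢
  have hle : (t₀ : ℝ) ≤ (t₀ + d : ℝ≥0) := NNReal.coe_le_coe.2 hT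
  -- The maximum of g is attained, so the hypothesis at `w` alone supplies an exponential moment
  -- dominating all the others.
  obtain ⟨w, hw, hmax⟩ := isCompact_Icc.exists_isMaxOn (Set.nonempty_Icc.2 hle)
    ((hc.pow 2).div_const 2).continuousOn
  have hcv : ∀ u ∈ Set.Icc (t₀ : ℝ) (t₀ + d : ℝ≥0), c u ^ 2 / 2 ≤ c w ^ 2 / 2 := fun u hu => hmax hu
  have hint : IntervalIntegrable (fun u : ℝ => TCBmCARMA.cumulant Q Λ (c u ^ 2 / 2)) volume
      t₀ (t₀ + d : ℝ≥0) :=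
    (TCBmCARMA.continuousOn_cumulant_comp (hΛ.measurable 1) (g := fun u => c u ^ 2 / 2)
      (by fun_prop) hcv (hk w hw)).intervalIntegrable_of_Icc hle
  -- the stochastic integral of `c` against the driving noise, as a limit of Riemann sums
  let J : Ω → ℝ := fun ω => b ⬝ᵥ X (t₀ + d) ω -
    TCBmCARMA.expFunctional (TCBmCARMA.companion a) b d (X t₀ ω)
  have hXF : Measurable[ℱ t₀]
      fun ω => TCBmCARMA.expFunctional (TCBmCARMA.companion a) b d (X t₀ ω) :=
    (ContinuousLinearMap.continuous _).measurable.comp (hX.adapted t₀)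
  have hJm : Measurable J := by
    refine Measurable.sub ?_ (hXF.mono (ℱ.le _) le_rfl)
    exact (by unfold dotProduct; fun_prop : Continuous fun x : Fin p → ℝ => b ⬝ᵥ x).measurable.comp
      (hXm _)
  have hJ : ∀ᵐ ω ∂Q, Tendsto (fun n => ∑ i ∈ Finset.range (n + 1),
      c (TCBmCARMA.gridPoint t₀ d n i) *
        (TCBmCARMA.timeChange W Λ (TCBmCARMA.gridPoint t₀ d n (i + 1)) ω -
          TCBmCARMA.timeChange W Λ (TCBmCARMA.gridPoint t₀ d n i) ω)) atTop (𝓝 (J ω)) := by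
    filter_upwards [hX.cadlag, hX.sde] with ω h1 h2
    exact TCBmCARMA.tendsto_noise_sum (ℓ := fun t => TCBmCARMA.timeChange W Λ t ω) h1 h2 t₀ d
  have hJind : Indep (MeasurableSpace.comap J inferInstance) (ℱ t₀) Q := by
    refine TCBmCARMA.indep_comap_of_tendsto (fun n => by fun_prop) hJm hJ fun n => ?_
    have := hL.indep_sum_increments (n + 1) (TCBmCARMA.gridPoint_mono t₀ d n)
      fun i => c (TCBmCARMA.gridPoint t₀ d n i)
    rwa [TCBmCARMA.gridPoint_zero] at this
  have hval := TCBmCARMA.lintegral_exp_noise_limit hW hΛ hWΛ hLm hc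
    (fun u hu => hcv u (by push_cast; exact hu)) (hk w hw) hJ
  rw [← NNReal.coe_add] at hval
  set I : ℝ := ∫ u in (t₀ : ℝ)..(t₀ + d : ℝ≥0), TCBmCARMA.cumulant Q Λ (c u ^ 2 / 2)
  let G : Ω → ℝ := fun ω => S t₀ ω *
    Real.exp (TCBmCARMA.expFunctional (TCBmCARMA.companion a) b d (X t₀ ω))
  have hG : Measurable[ℱ t₀] fun ω => ENNReal.ofReal (G ω) :=
    ENNReal.measurable_ofReal.comp ((hS_adapted t₀).mul (Real.measurable_exp.comp hXF))
  have hH : Measurable fun x : ℝ => ENNReal.ofReal (Real.exp x) := by fun_prop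
  have hcond := TCBmCARMA.condLExp_mul_of_indep (ℱ.le t₀) hG (hH.comp hJm)
    (indep_of_indep_of_le_left hJind (by
      rw [← MeasurableSpace.comap_comp]
      exact MeasurableSpace.comap_mono hH.comap_le))
  -- The spot price splits into a factor known at t₀ and the independent factor e^J.
  have hST : (fun ω => ENNReal.ofReal (S (t₀ + d) ω)) =ᵐ[Q] fun ω =>
      ENNReal.ofReal (G ω) * ((fun x : ℝ => ENNReal.ofReal (Real.exp x)) ∘ J) ω := by
    filter_upwards [hS] with ω hω
    rw [Function.comp_apply, ← ENNReal.ofReal_mul' (Real.exp_pos _).le, mul_assoc, ← Real.exp_add,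
      add_sub_cancel, hω]
  have hF : ∀ᵐ ω ∂Q, TCBmCARMA.futuresPrice Q ℱ S t₀ (t₀ + d) ω =
      ENNReal.ofReal (G ω * Real.exp I) := by
    filter_upwards [condLExp_congr_ae (mΩ := ℱ t₀) hST, hcond] with ω h1 h2
    rw [TCBmCARMA.futuresPrice, h1, h2, ENNReal.ofReal_mul' (p := G ω) (Real.exp_pos I).le]
    exact congrArg _ hval
  have hlog : ∀ ω, 0 < S t₀ ω → 0 < G ω * Real.exp I ∧ Real.log (G ω * Real.exp I) =
      Real.log (S t₀ ω) + b ⬝ᵥ (NormedSpace.exp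
        ((((t₀ + d : ℝ≥0) : ℝ) - t₀) • TCBmCARMA.companion a) *ᵥ X t₀ ω) + I := by
    intro ω hω
    have hGpos : 0 < G ω := mul_pos hω (Real.exp_pos _)
    refine ⟨mul_pos hGpos (Real.exp_pos _), ?_⟩
    have : ((t₀ + d : ℝ≥0) : ℝ) - t₀ = d := by push_cast; ring
    rw [Real.log_mul hGpos.ne' (Real.exp_pos _).ne', Real.log_exp,
      Real.log_mul hω.ne' (Real.exp_pos _).ne', Real.log_exp, this,
      TCBmCARMA.expFunctional_apply]
  refine ⟨hint, ?_, fun hSint => ?_⟩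
  · filter_upwards [hF, hS_pos] with ω h1 h2
    obtain ⟨h3, h4⟩ := hlog ω h2
    rw [h1, ENNReal.toReal_ofReal h3.le]
    exact ⟨ENNReal.ofReal_pos.2 h3, ENNReal.ofReal_lt_top, h4⟩
  · have hnonneg : 0 ≤ᵐ[Q] S (t₀ + d) := by
      filter_upwards [hS, hS_pos] with ω h1 h2
      rw [h1]
      exact (mul_pos h2 (Real.exp_pos _)).le
    filter_upwards [hF, hS_pos, condLExp_ofReal (ℱ t₀) hSint hnonneg] with ω h1 h2 h5
    obtain ⟨h3, h4⟩ := hlog ω h2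
    rw [TCBmCARMA.futuresPrice, h5] at h1
    have h6 : 0 < (Q[S (t₀ + d) | ℱ t₀]) ω :=
      ENNReal.ofReal_pos.1 (by rw [h1]; exact ENNReal.ofReal_pos.2 h3)
    rw [ENNReal.ofReal_eq_ofReal_iff h6.le h3.le] at h1
    exact ⟨h6, by rw [h1]; exact h4⟩
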